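/- Let $\mathbb{D}$ be the open unit disc and let $p\in(0,1)$. Let $Co(p)$ be the class of functions $f:\mathbb{D}\to\overline{\mathbb{C}}$ that satisfy the following conditions: (i) $f$ is meromorphic in $\mathbb{D}$ and has a simple pole at $p$; (ii) $f(0)=0$ and $f'(0)=1$; (iii) $f$ maps $\mathbb{D}$ conformally (injectively) onto a set whose complement with respect to $\overline{\mathbb{C}}$ is convex. Each $f\in Co(p)$ has a Laurent expansion $$f(z)=\sum_{n=-1}^{\infty}a_n(f)(z-p)^n,\qquad 0<|z-p|<1-p.$$ For every $f\in Co(p)$, $$\operatorname{Re} a_0(f)\ \ge\ -\frac{p}{(1-p^2)^2}.$$ Equality holds if and only if $$f(z)=\frac{z}{\left(1-\frac{z}{p}\right)(1-zp)},\qquad z\in\mathbb{D},$$ and this function belongs to $Co(p)$, so that the bound is attained. -/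

import Mathlib

open Metric Set

noncomputable section

/-- The affine coordinate on the Riemann sphere `OnePoint ℂ`; the point at infinity, which has
no affine coordinate, is sent to the dummy value `0`. -/
def sphereCoord (w : OnePoint ℂ) : ℂ := w.elim 0 id

/-- A map `f` into the Riemann sphere is meromorphic on the open set `U`: at every point of `U`
it either takes a finite value and is holomorphic there, or takes the value `∞` and has a pole
there. Only the values of `f` on `U` matter. -/
def MeromorphicToSphereOn (f : ℂ → OnePoint ℂ) (U : Set ℂ) : Prop :=
  ∀ z ∈ U,
    (f z ≠ OnePoint.infty ∧ AnalyticAt ℂ (sphereCoord ∘ f) z) ∨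
    (f z = OnePoint.infty ∧ MeromorphicAt (sphereCoord ∘ f) z ∧
      meromorphicOrderAt (sphereCoord ∘ f) z < 0)

/-- The class `Co(p)` of concave univalent functions with pole `p`. A function on the open unit
disc is represented by a function on `ℂ` of which only the values on the disc are used. The
complement of the image never contains `∞`, because `f` takes the value `∞` at its pole, so that
the complement is the subset of `ℂ` in the last field. -/
structure ConcaveUnivalent (p : ℝ) (f : ℂ → OnePoint ℂ) : Prop where
  meromorphic : MeromorphicToSphereOn f (ball 0 1)
  simple_pole : meromorphicOrderAt (sphereCoord ∘ f) (p : ℂ) = -1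
  map_zero : f 0 = ((0 : ℂ) : OnePoint ℂ)
  deriv_zero : deriv (sphereCoord ∘ f) 0 = 1
  injective : InjOn f (ball 0 1)
  convex_compl : Convex ℝ {w : ℂ | (w : OnePoint ℂ) ∈ (f '' ball 0 1)ᶜ}

/-- `f(z) = ∑_{n ≥ -1} a_n (z - p)^n` for `0 < |z - p| < 1 - p`: the numbers `a n`, `n ≥ -1`, are
the Laurent coefficients of `f` at its simple pole `p`. -/
def HasLaurentExpansion (p : ℝ) (f : ℂ → OnePoint ℂ) (a : ℤ → ℂ) : Prop :=
  ∀ z : ℂ, 0 < ‖z - p‖ → ‖z - p‖ < 1 - p →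
    HasSum (fun n : {n : ℤ // -1 ≤ n} => a n * (z - p) ^ (n : ℤ)) (sphereCoord (f z))

/-- The function `z / ((1 - z/p)(1 - zp))`, with its value `∞` at the pole `p`. -/
def concaveExtremal (p : ℝ) (z : ℂ) : OnePoint ℂ :=
  open Classical in
  if z = p then OnePoint.infty
  else ((z / ((1 - z / p) * (1 - z * p)) : ℂ) : OnePoint ℂ)

end

/-! Write f = A/(z-p) + F with F holomorphic on the disc, so that a_0 = F(p). The automorphism
`discShift p` sends 0 to p and -p to 0, and turns f into b/ζ + k(ζ) with b = A/(1-p²) and k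
holomorphic. The crux is the bound |k'| ≤ |b| (`norm_deriv_regular_part_le`). At ζ = -p it says
|F'(0)| ≤ |A|. Since f'(0) = 1 means F'(0) = 1 + A/p², this forces |A| ≤ p²/(1-p²). Integrated from
-p to 0 it gives |F(0) - F(p)| ≤ |A|p/(1-p²), while f(0) = 0 means F(0) = A/p. Together, Re F(p) ≥
-|A|/(p(1-p²)) ≥ -p/(1-p²)². Equality fixes A and F(0) - F(p) and, by the maximum principle, makes k
affine, so f is determined.

For the crux put h = b/z + k. Convexity of the omitted set passes to the level curves h(|z| = r), by
the maximum principle applied to z divided by the preimage of a midpoint (`norm_le_of_midpoint_eq`).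
Comparing second-order terms along a circle yields Re(1 + z h''/h') ≤ 0 (`re_curvature_nonpos`),
that is, |z|²|2k' + zk''| ≤ |2b + z³k''|. Where |k'| is maximal on |z| ≤ r one has zk'' = mk' with m
≥ 0 (`exists_mul_deriv_eq_of_isMaxOn`); then m cancels and r²|k'| ≤ |b| remains. Let r tend to 1. -/

section

open Filter Topology

/-! ### Univalent functions and a Taylor expansion -/

/-- An injective holomorphic function is open at every point. -/
lemma nhds_le_map_of_injOn {U : Set ℂ} (hU : IsOpen U) {h : ℂ → ℂ}
    (hd : DifferentiableOn ℂ h U) (hi : InjOn h U) {z : ℂ} (hz : z ∈ U) :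
    𝓝 (h z) ≤ map h (𝓝 z) := by
  have ha : AnalyticAt ℂ h z := hd.analyticAt (hU.mem_nhds hz)
  refine ha.eventually_constant_or_nhds_le_map_nhds.resolve_left fun hc => ?_
  have h1 : ∀ᶠ w in 𝓝[≠] z, h w = h z ∧ w ∈ U ∧ w ≠ z := by
    filter_upwards [hc.filter_mono nhdsWithin_le_nhds,
      mem_nhdsWithin_of_mem_nhds (hU.mem_nhds hz), self_mem_nhdsWithin] with w a b c
    exact ⟨a, b, c⟩
  obtain ⟨w, a, b, c⟩ := h1.exists
  exact c (hi b hz a)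

lemma isOpen_image_of_injOn {U : Set ℂ} (hU : IsOpen U) {h : ℂ → ℂ}
    (hd : DifferentiableOn ℂ h U) (hi : InjOn h U) : IsOpen (h '' U) := by
  rw [isOpen_iff_mem_nhds]
  rintro _ ⟨z, hz, rfl⟩
  exact nhds_le_map_of_injOn hU hd hi hz (image_mem_map (hU.mem_nhds hz))

/-- The inverse of an injective holomorphic function is holomorphic. -/
lemma exists_differentiableOn_inverse {U : Set ℂ} (hU : IsOpen U) {h : ℂ → ℂ}
    (hd : DifferentiableOn ℂ h U) (hi : InjOn h U) :
    ∃ g : ℂ → ℂ, DifferentiableOn ℂ g (h '' U) ∧ ∀ z ∈ U, g (h z) = z := by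
  refine ⟨Function.invFunOn h U, ?_, fun z hz => hi.leftInvOn_invFunOn hz⟩
  set g := Function.invFunOn h U
  have hg : ∀ z ∈ U, g (h z) = z := fun z hz => hi.leftInvOn_invFunOn hz
  have hO := isOpen_image_of_injOn hU hd hi
  have hcont : ∀ w ∈ h '' U, ContinuousAt g w := by
    rintro _ ⟨z, hz, rfl⟩
    rw [ContinuousAt, hg z hz]
    intro V hV
    have h1 : h '' (V ∩ U) ∈ 𝓝 (h z) :=
      nhds_le_map_of_injOn hU hd hi hz (image_mem_map (inter_mem hV (hU.mem_nhds hz)))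
    rw [mem_map]
    filter_upwards [h1]
    rintro _ ⟨x, hx, rfl⟩
    rw [mem_preimage, hg x hx.2]
    exact hx.1
  have hdiff : ∀ z ∈ U, deriv h z ≠ 0 → DifferentiableAt ℂ g (h z) := by
    intro z hz hne
    have h2 : HasDerivAt h (deriv h z) (g (h z)) := by
      rw [hg z hz]
      exact (hd.differentiableAt (hU.mem_nhds hz)).hasDerivAt
    refine (HasDerivAt.of_local_left_inverse (hcont _ ⟨z, hz, rfl⟩) h2 hne ?_).differentiableAt
    filter_upwards [hO.mem_nhds ⟨z, hz, rfl⟩]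
    rintro _ ⟨x, hx, rfl⟩
    rw [hg x hx]
  rintro _ ⟨z, hz, rfl⟩
  apply DifferentiableAt.differentiableWithinAt
  have hda : AnalyticAt ℂ (deriv h) z := (hd.analyticAt (hU.mem_nhds hz)).deriv
  -- Zeros of h' are isolated, since otherwise h would be locally constant. So g is holomorphic on a
  -- punctured neighbourhood of h z and continuous at h z: the singularity is removable, and h' z ≠
  -- 0 is never needed.
  have hne : ∀ᶠ x in 𝓝[≠] z, deriv h x ≠ 0 := by
    refine hda.eventually_eq_zero_or_eventually_ne_zero.resolve_left fun hc => ?_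
    obtain ⟨r, hr, hr'⟩ := Metric.eventually_nhds_iff_ball.1 (hc.and (hU.mem_nhds hz))
    have hconst : ∀ x ∈ ball z r, h x = h z := by
      intro x hx
      refine (convex_ball z r).is_const_of_fderivWithin_eq_zero (𝕜 := ℂ)
        (hd.mono fun y hy => (hr' y hy).2) (fun y hy => ?_) hx (mem_ball_self hr)
      rw [fderivWithin_of_isOpen isOpen_ball hy]
      ext
      simpa using (hr' y hy).1
    have h1 : ∀ᶠ w in 𝓝[≠] z, w ∈ ball z r ∧ w ≠ z := by
      filter_upwards [mem_nhdsWithin_of_mem_nhds (ball_mem_nhds z hr),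
        self_mem_nhdsWithin] with w a b
      exact ⟨a, b⟩
    obtain ⟨w, a, b⟩ := h1.exists
    exact b (hi (hr' w a).2 hz (hconst w a))
  obtain ⟨V, hV, hV'⟩ : ∃ V ∈ 𝓝 z, ∀ x ∈ V, x ≠ z → deriv h x ≠ 0 := by
    rw [eventually_nhdsWithin_iff] at hne
    exact ⟨_, hne, fun x hx hx' => hx hx'⟩
  set N := h '' (V ∩ U)
  have hN : N ∈ 𝓝 (h z) :=
    nhds_le_map_of_injOn hU hd hi hz (image_mem_map (inter_mem hV (hU.mem_nhds hz)))
  refine ((Complex.differentiableOn_compl_singleton_and_continuousAt_iff hN).1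
    ⟨?_, hcont _ ⟨z, hz, rfl⟩⟩).differentiableAt hN
  rintro _ ⟨⟨x, hx, rfl⟩, hxz⟩
  refine (hdiff x hx.2 (hV' x hx.1 ?_)).differentiableWithinAt
  rintro rfl
  exact hxz rfl

/-- Second-order Taylor expansion with a continuous remainder factor. -/
lemma exists_second_order_expansion {G G' : ℂ → ℂ} {G'' c : ℂ}
    (hG : ∀ᶠ t in 𝓝 c, HasDerivAt G (G' t) t) (hG' : HasDerivAt G' G'' c) :
    ∃ Q : ℂ → ℂ, ContinuousAt Q c ∧ Q c = G'' / 2 ∧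
      ∀ t, G t = G c + (t - c) * G' c + (t - c) ^ 2 * Q t := by
  obtain ⟨s, hs, hso, hcs⟩ := _root_.eventually_nhds_iff.1 hG
  have hsn : s ∈ 𝓝 c := hso.mem_nhds hcs
  have hGd : DifferentiableOn ℂ G s := fun t ht => (hs t ht).differentiableAt.differentiableWithinAt
  have h1 : DifferentiableOn ℂ (dslope G c) s := (Complex.differentiableOn_dslope hsn).2 hGd
  have h2 : DifferentiableOn ℂ (dslope (dslope G c) c) s := (Complex.differentiableOn_dslope hsn).2 h1
  set Q := dslope (dslope G c) c with hQ
  have hd1 : dslope G c c = G' c := by rw [dslope_same, (hs c hcs).deriv]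
  have hexp : ∀ t, G t = G c + (t - c) * G' c + (t - c) ^ 2 * Q t := by
    intro t
    have a := sub_smul_dslope G c t
    have b := sub_smul_dslope (dslope G c) c t
    rw [hd1] at b
    simp only [smul_eq_mul] at a b
    linear_combination -a - (t - c) * b
  have hQd : ∀ t ∈ s, HasDerivAt Q (deriv Q t) t := fun t ht =>
    (h2.differentiableAt (hso.mem_nhds ht)).hasDerivAt
  refine ⟨Q, (hQd c hcs).continuousAt, ?_, hexp⟩
  have hQ'd : DifferentiableAt ℂ (deriv Q) c := (h2.analyticAt hsn).deriv.differentiableAt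
  -- Q c is found by differentiating the expansion twice and comparing with G''.
  have h3 : ∀ᶠ t in 𝓝 c, G' t = G' c + 2 * (t - c) * Q t + (t - c) ^ 2 * deriv Q t := by
    filter_upwards [hsn] with t ht
    have hlin : HasDerivAt (fun t : ℂ => t - c) 1 t := (hasDerivAt_id t).sub_const c
    have e := ((hlin.mul_const (G' c)).const_add (G c)).add ((hlin.pow 2).mul (hQd t ht))
    have e' := e.congr_of_eventuallyEq (f₁ := G) (Eventually.of_forall fun t => by
      simp [hexp t])
    rw [(hs t ht).unique e']
    simp [add_assoc]
  have hlin : HasDerivAt (fun t : ℂ => t - c) 1 c := (hasDerivAt_id c).sub_const c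
  have e := (((hlin.const_mul 2).mul (hQd c hcs)).const_add (G' c)).add
    ((hlin.pow 2).mul hQ'd.hasDerivAt)
  have e' := hG'.unique (e.congr_of_eventuallyEq (f₁ := G') (by
    filter_upwards [h3] with t ht
    simp [ht]))
  simp at e'
  rw [e']; ring

/-! ### Maps with a simple pole: boundary behaviour -/

lemma isOpen_punctured_ball : IsOpen (ball (0 : ℂ) 1 \ {0}) := isOpen_ball.sdiff isClosed_singleton

lemma differentiableOn_add_pole {b : ℂ} {k : ℂ → ℂ} (hk : DifferentiableOn ℂ k (ball 0 1)) :
    DifferentiableOn ℂ (fun z => b / z + k z) (ball 0 1 \ {0}) :=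
  ((differentiableOn_const b).div differentiableOn_id fun _ hz => hz.2).add (hk.mono sdiff_subset)

/-- The values near a pole cover a neighbourhood of infinity. -/
lemma exists_large_subset_image {b : ℂ} (hb : b ≠ 0) {k : ℂ → ℂ}
    (hk : DifferentiableOn ℂ k (ball 0 1)) :
    ∃ R : ℝ, ∀ w : ℂ, R < ‖w‖ → ∃ z ∈ closedBall (0 : ℂ) (1 / 2) \ {0}, b / z + k z = w := by
  -- q is the reciprocal of the map off 0; it is holomorphic at 0 with q 0 = 0, and openness there
  -- covers a neighbourhood of infinity.
  set q : ℂ → ℂ := fun z => z / (b + z * k z)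
  have hden : AnalyticAt ℂ (fun z => b + z * k z) 0 :=
    analyticAt_const.add (analyticAt_id.mul (hk.analyticAt (ball_mem_nhds 0 one_pos)))
  have hq : AnalyticAt ℂ q 0 := analyticAt_id.div hden (by simpa using hb)
  have hden0 : ∀ᶠ z in 𝓝 (0 : ℂ), b + z * k z ≠ 0 :=
    hden.continuousAt.eventually_ne (by simpa using hb)
  have hmap : 𝓝 (q 0) ≤ map q (𝓝 0) := by
    refine hq.eventually_constant_or_nhds_le_map_nhds.resolve_left fun hc => ?_
    have h1 : ∀ᶠ w in 𝓝[≠] (0 : ℂ), q w = q 0 ∧ b + w * k w ≠ 0 ∧ w ≠ 0 := by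
      filter_upwards [hc.filter_mono nhdsWithin_le_nhds, hden0.filter_mono nhdsWithin_le_nhds,
        self_mem_nhdsWithin] with w a b c
      exact ⟨a, b, c⟩
    obtain ⟨w, h1, h2, h3⟩ := h1.exists
    simp [q, h2, h3] at h1
  have himg : q '' (ball 0 (1 / 2) ∩ {z | b + z * k z ≠ 0}) ∈ 𝓝 (0 : ℂ) := by
    have hq0 : q 0 = 0 := by simp [q]
    have := hmap (image_mem_map (inter_mem (ball_mem_nhds 0 (by norm_num : (0 : ℝ) < 1 / 2)) hden0))
    rwa [hq0] at this
  obtain ⟨ε, hε, hsub⟩ := Metric.mem_nhds_iff.1 himg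
  refine ⟨1 / ε, fun w hw => ?_⟩
  have hw0 : 0 < ‖w‖ := (by positivity : (0 : ℝ) < 1 / ε).trans hw
  have hwne : w ≠ 0 := norm_pos_iff.1 hw0
  have h1 : w⁻¹ ∈ ball (0 : ℂ) ε := by
    rw [mem_ball_zero_iff, norm_inv]
    rw [div_lt_iff₀ hε] at hw
    rw [inv_lt_iff_one_lt_mul₀ hw0]
    linarith
  obtain ⟨z, ⟨hz, hz'⟩, hzw⟩ := hsub h1
  have hz' : b + z * k z ≠ 0 := hz'
  have hz0 : z ≠ 0 := by
    rintro rfl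
    simp [q, hwne, eq_comm] at hzw
  refine ⟨z, ⟨ball_subset_closedBall hz, hz0⟩, ?_⟩
  have : w = (z / (b + z * k z))⁻¹ := by rw [← inv_inj, inv_inv]; exact hzw.symm
  rw [this]
  field_simp

/-- Near the unit circle, the values of the map are close to the omitted set. -/
lemma exists_radius_mem_thickening {b : ℂ} (hb : b ≠ 0) {k : ℂ → ℂ}
    (hk : DifferentiableOn ℂ k (ball 0 1))
    (hi : InjOn (fun z => b / z + k z) (ball 0 1 \ {0})) {δ : ℝ} (hδ : 0 < δ) :
    ∃ ρ < 1, ∀ z ∈ ball (0 : ℂ) 1 \ {0}, ρ < ‖z‖ →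
      b / z + k z ∈ thickening δ ((fun z => b / z + k z) '' (ball 0 1 \ {0}))ᶜ := by
  obtain ⟨R, hR⟩ := exists_large_subset_image hb hk
  have hd := differentiableOn_add_pole (b := b) hk
  set h : ℂ → ℂ := fun z => b / z + k z with hh
  obtain ⟨g, hg, hgh⟩ := exists_differentiableOn_inverse isOpen_punctured_ball hd hi
  set K := (h '' (ball 0 1 \ {0}))ᶜ
  -- This compact set consists of attained values, so its preimage is compact and lies in some |z| ≤
  -- ρ < 1.
  have hC : IsCompact (closedBall (0 : ℂ) R \ thickening δ K) :=
    (isCompact_closedBall 0 R).diff isOpen_thickening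
  have hCs : closedBall (0 : ℂ) R \ thickening δ K ⊆ h '' (ball 0 1 \ {0}) := by
    intro w hw
    by_contra hw'
    exact hw.2 (self_subset_thickening hδ K hw')
  have hgC : IsCompact (g '' (closedBall (0 : ℂ) R \ thickening δ K)) :=
    hC.image_of_continuousOn (hg.continuousOn.mono hCs)
  have hgs : g '' (closedBall (0 : ℂ) R \ thickening δ K) ⊆ ball 0 1 := by
    rintro _ ⟨w, hw, rfl⟩
    obtain ⟨z, hz, rfl⟩ := hCs hw
    rw [hgh z hz]
    exact hz.1
  obtain ⟨ρ, hρ, hρ'⟩ : ∃ ρ < 1, ∀ z ∈ g '' (closedBall (0 : ℂ) R \ thickening δ K), ‖z‖ ≤ ρ := by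
    rcases (g '' (closedBall (0 : ℂ) R \ thickening δ K)).eq_empty_or_nonempty with he | hne
    · exact ⟨0, one_pos, by simp [he]⟩
    · obtain ⟨z, hz, hz'⟩ := hgC.exists_isMaxOn hne continuous_norm.continuousOn
      exact ⟨‖z‖, mem_ball_zero_iff.1 (hgs hz), fun y hy => hz' hy⟩
  -- Values of modulus above R are already taken in |z| ≤ 1/2, so by injectivity none occurs for |z|
  -- > 1/2.
  refine ⟨max (1 / 2) ρ, max_lt (by norm_num) hρ, fun z hz hlt => ?_⟩
  by_contra hcon
  by_cases hzR : ‖h z‖ ≤ R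
  · have := hρ' (g (h z)) ⟨h z, ⟨mem_closedBall_zero_iff.2 hzR, hcon⟩, rfl⟩
    rw [hgh z hz] at this
    exact absurd ((le_max_right _ _).trans_lt hlt) (not_lt.2 this)
  · obtain ⟨y, hy, hyz⟩ := hR (h z) (not_le.1 hzR)
    have hyb := mem_closedBall_zero_iff.1 hy.1
    have : y = z := hi ⟨mem_ball_zero_iff.2 (by linarith), hy.2⟩ hz hyz
    rw [this] at hyb
    exact absurd ((le_max_left _ _).trans_lt hlt) (not_lt.2 hyb)

/-- The values on a smaller disc stay away from the omitted set. -/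
lemma exists_notMem_thickening {b : ℂ} (hb : b ≠ 0) {k : ℂ → ℂ}
    (hk : DifferentiableOn ℂ k (ball 0 1))
    (hi : InjOn (fun z => b / z + k z) (ball 0 1 \ {0})) {r : ℝ} (hr : r < 1) :
    ∃ δ > 0, ∀ z ∈ ball (0 : ℂ) 1 \ {0}, ‖z‖ ≤ r →
      b / z + k z ∉ thickening δ ((fun z => b / z + k z) '' (ball 0 1 \ {0}))ᶜ := by
  obtain ⟨R, hR⟩ := exists_large_subset_image hb hk
  have hd := differentiableOn_add_pole (b := b) hk
  set h : ℂ → ℂ := fun z => b / z + k z with hh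
  set K := (h '' (ball 0 1 \ {0}))ᶜ with hK
  have hKR : ∀ w ∈ K, ‖w‖ ≤ R := by
    intro w hw
    by_contra hcon
    obtain ⟨z, hz, hzw⟩ := hR w (not_le.1 hcon)
    have := mem_closedBall_zero_iff.1 hz.1
    exact hw ⟨z, ⟨mem_ball_zero_iff.2 (by linarith), hz.2⟩, hzw⟩
  obtain ⟨C, hC⟩ := (isCompact_closedBall (0 : ℂ) r).exists_bound_of_continuousOn
    (hk.continuousOn.mono (closedBall_subset_ball hr))
  have hC' : ∀ z : ℂ, z ≠ 0 → ‖z‖ ≤ r → ‖h z‖ ≤ R + 1 → ‖b‖ / (|R| + 1 + |C|) ≤ ‖z‖ := by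
    intro z hz0 hz hhz
    have h1 := hC z (mem_closedBall_zero_iff.2 hz)
    have h2 : ‖b / z‖ ≤ |R| + 1 + |C| := by
      calc ‖b / z‖ = ‖h z - k z‖ := by simp [hh]
        _ ≤ ‖h z‖ + ‖k z‖ := norm_sub_le _ _
        _ ≤ _ := by linarith [le_abs_self R, le_abs_self C]
    rw [norm_div, div_le_iff₀ (norm_pos_iff.2 hz0)] at h2
    rw [div_le_iff₀ (by positivity)]
    linarith
  -- If |h z| ≤ R + 1 then b/z = h z - k z is bounded, so z stays in the compact annulus `S`. If |h
  -- z| > R + 1, then h z is at distance more than 1 from K; hence `min δ 1` below.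
  set ε := ‖b‖ / (|R| + 1 + |C|)
  have hε : 0 < ε := by have := norm_pos_iff.2 hb; positivity
  set S := closedBall (0 : ℂ) r \ ball 0 ε
  have hS : S ⊆ ball 0 1 \ {0} := by
    intro z hz
    refine ⟨closedBall_subset_ball hr hz.1, ?_⟩
    rintro rfl
    exact hz.2 (mem_ball_self hε)
  have hSc : IsCompact (h '' S) :=
    ((isCompact_closedBall 0 r).diff isOpen_ball).image_of_continuousOn (hd.continuousOn.mono hS)
  obtain ⟨δ, hδ, hδ'⟩ := hSc.exists_thickening_subset_open
    (isOpen_image_of_injOn isOpen_punctured_ball hd hi) (image_mono hS)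
  refine ⟨min δ 1, lt_min hδ one_pos, fun z hz hzr hmem => ?_⟩
  obtain ⟨w, hw, hwz⟩ := mem_thickening_iff.1 hmem
  by_cases hhz : ‖h z‖ ≤ R + 1
  · refine hw (hδ' (mem_thickening_iff.2 ⟨h z, ⟨z, ⟨mem_closedBall_zero_iff.2 hzr, ?_⟩, rfl⟩, ?_⟩))
    · rw [mem_ball_zero_iff, not_lt]
      exact hC' z hz.2 hzr hhz
    · rw [dist_comm]
      exact hwz.trans_le (min_le_left _ _)
  · have h1 := hKR w hw
    have h2 : ‖h z‖ ≤ ‖h z - w‖ + ‖w‖ := by simpa using norm_add_le (h z - w) w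
    have h3 : ‖h z - w‖ < 1 := by
      rw [← dist_eq_norm]
      exact hwz.trans_le (min_le_right _ _)
    linarith

/-! ### Convexity of level curves and the curvature inequality -/

/-- The exterior level curves of a map onto the exterior of a convex set are convex: the midpoint
of two points on a level curve does not lie outside that curve. -/
lemma norm_le_of_midpoint_eq {b : ℂ} (hb : b ≠ 0) {k : ℂ → ℂ}
    (hk : DifferentiableOn ℂ k (ball 0 1))
    (hi : InjOn (fun z => b / z + k z) (ball 0 1 \ {0}))
    (hc : Convex ℝ ((fun z => b / z + k z) '' (ball 0 1 \ {0}))ᶜ) {η : ℂ} (hη : ‖η‖ = 1)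
    {x y : ℂ} (hx : x ∈ ball (0 : ℂ) 1 \ {0}) (hy : y ∈ ball (0 : ℂ) 1 \ {0})
    (hxy : b / y + k y = ((b / x + k x) + (b / (η * x) + k (η * x))) / 2) : ‖x‖ ≤ ‖y‖ := by
  have hd := differentiableOn_add_pole (b := b) hk
  have hthick := fun r hr => exists_notMem_thickening hb hk hi (r := r) hr
  have hrad := fun δ hδ => exists_radius_mem_thickening hb hk hi (δ := δ) hδ
  set h : ℂ → ℂ := fun z => b / z + k z with hh
  obtain ⟨g, hg, hgh⟩ := exists_differentiableOn_inverse isOpen_punctured_ball hd hi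
  have hUη : ∀ z ∈ ball (0 : ℂ) 1 \ {0}, η * z ∈ ball (0 : ℂ) 1 \ {0} := by
    intro z hz
    have hη0 : η ≠ 0 := norm_pos_iff.1 (by rw [hη]; exact one_pos)
    refine ⟨by simpa [hη] using hz.1, mul_ne_zero hη0 hz.2⟩
  set U := ball (0 : ℂ) 1 \ {0} with hU
  set K := (h '' U)ᶜ with hK
  set m : ℂ → ℂ := fun z => (h z + h (η * z)) / 2 with hm
  have hmd : DifferentiableOn ℂ m U := by
    refine (hd.add (hd.comp ?_ hUη)).div_const 2
    exact (differentiableOn_const η).mul differentiableOn_id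
  have hOo : IsOpen (h '' U) := isOpen_image_of_injOn isOpen_punctured_ball hd hi
  set O := U ∩ m ⁻¹' (h '' U) with hO
  have hOopen : IsOpen O := hmd.continuousOn.isOpen_inter_preimage isOpen_punctured_ball hOo
  -- The claim is |v| ≤ 1. Since v is only defined where the midpoint is an attained value, the
  -- maximum principle is applied on the set W where |v| > L > 1, once W is shown to have its
  -- closure inside O.
  set v : ℂ → ℂ := fun z => z / g (m z) with hv
  have hgU : ∀ w ∈ h '' U, g w ∈ U ∧ h (g w) = w := by
    rintro _ ⟨z, hz, rfl⟩
    rw [hgh z hz]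
    exact ⟨hz, rfl⟩
  have hvd : DifferentiableOn ℂ v O := by
    refine differentiableOn_id.div (hg.comp (hmd.mono inter_subset_left) fun z hz => hz.2) ?_
    exact fun z hz => (hgU _ hz.2).1.2
  by_contra! hlt
  have hy0 : 0 < ‖y‖ := norm_pos_iff.2 hy.2
  have hL0 : 1 < ‖x‖ / ‖y‖ := by rwa [one_lt_div hy0]
  obtain ⟨L, hL1, hL⟩ := exists_between hL0
  have hxm : m x = h y := hxy.symm
  have hxO : x ∈ O := ⟨hx, y, hy, hxy⟩
  have hvx : L < ‖v x‖ := by rw [hv]; simpa [hxm, hgh y hy] using hL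
  set W := O ∩ v ⁻¹' {w | L < ‖w‖} with hW
  have hWo : IsOpen W := hvd.continuousOn.isOpen_inter_preimage hOopen
    (isOpen_lt continuous_const continuous_norm)
  -- On W the preimage of the midpoint has modulus below 1/L, so the midpoint keeps distance δ from
  -- K. For |z| > ρ both endpoints lie in the δ-thickening of K, which is convex and would contain
  -- the midpoint: W avoids the unit circle.
  obtain ⟨δ, hδ, hδ'⟩ := hthick (1 / L) (by rw [div_lt_one (by linarith)]; exact hL1)
  obtain ⟨ρ, hρ, hρ'⟩ := hrad δ hδ
  have hWg : ∀ z ∈ W, L * ‖g (m z)‖ < ‖z‖ := by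
    intro z hz
    have h1 : L < ‖z / g (m z)‖ := hz.2
    rwa [norm_div, lt_div_iff₀ (norm_pos_iff.2 (hgU _ hz.1.2).1.2)] at h1
  have hWm : ∀ z ∈ W, m z ∉ thickening δ K := by
    intro z hz
    obtain ⟨h1, h2⟩ := hgU _ hz.1.2
    rw [← h2]
    refine hδ' _ h1 ?_
    have h3 := hWg z hz
    have h4 : ‖z‖ < 1 := mem_ball_zero_iff.1 hz.1.1.1
    rw [le_div_iff₀ (by linarith)]
    linarith
  have hWρ : ∀ z ∈ W, ‖z‖ ≤ ρ := by
    intro z hz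
    by_contra! hcon
    refine hWm z hz ?_
    have h1 := hρ' z hz.1.1 hcon
    have h2 := hρ' (η * z) (hUη z hz.1.1) (by rwa [norm_mul, hη, one_mul])
    have h3 := (hc.thickening δ) h1 h2 (a := 1 / 2) (b := 1 / 2) (by norm_num) (by norm_num)
      (by norm_num)
    convert h3 using 1
    simp only [hm, hh, Complex.real_smul]
    push_cast
    ring
  obtain ⟨C, hC⟩ := (isCompact_closedBall (0 : ℂ) (1 / 2)).exists_bound_of_continuousOn
    (hk.continuousOn.mono (closedBall_subset_ball (by norm_num)))
  have hbpos : 0 < ‖b‖ := norm_pos_iff.2 hb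
  -- Near the pole, |b|/|φ| ≤ |b|/|z| + 2|C| gives |v| ≤ 1 + 2|C||z|/|b|. This ε makes the right
  -- side less than L, so W avoids 0.
  set ε := min (1 / 2) (‖b‖ * (L - 1) / (2 * (|C| + 1))) with hε
  have hεpos : 0 < ε := by
    have : 0 < L - 1 := by linarith
    positivity
  have hWε : ∀ z ∈ W, ε ≤ ‖z‖ := by
    intro z hz
    by_contra! hcon
    have hz2 : ‖z‖ < 1 / 2 := hcon.trans_le (min_le_left _ _)
    have hz3 := hcon.trans_le (min_le_right _ _)
    have hzpos : 0 < ‖z‖ := norm_pos_iff.2 hz.1.1.2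
    obtain ⟨h1, h2⟩ := hgU _ hz.1.2
    have h3 := hWg z hz
    set φ := g (m z) with hφ
    have hφpos : 0 < ‖φ‖ := norm_pos_iff.2 h1.2
    have hφ2 : ‖φ‖ ≤ 1 / 2 := by nlinarith
    have hCφ := hC φ (mem_closedBall_zero_iff.2 hφ2)
    have hCz := hC z (mem_closedBall_zero_iff.2 hz2.le)
    have hCηz := hC (η * z) (mem_closedBall_zero_iff.2 (by rw [norm_mul, hη, one_mul]; exact hz2.le))
    have h4 : b / φ = ((b / z + k z) + (b / (η * z) + k (η * z))) / 2 - k φ := by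
      have : b / φ + k φ = ((b / z + k z) + (b / (η * z) + k (η * z))) / 2 := h2
      rw [← this]; ring
    have h5 : ‖b‖ / ‖φ‖ ≤ ‖b‖ / ‖z‖ + 2 * |C| := by
      rw [← norm_div, h4]
      have e1 : ‖b / z‖ = ‖b‖ / ‖z‖ := norm_div _ _
      have e2 : ‖b / (η * z)‖ = ‖b‖ / ‖z‖ := by rw [norm_div, norm_mul, hη, one_mul]
      have e3 := norm_sub_le (((b / z + k z) + (b / (η * z) + k (η * z))) / 2) (k φ)
      have e4 : ‖((b / z + k z) + (b / (η * z) + k (η * z))) / 2‖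
          = ‖(b / z + k z) + (b / (η * z) + k (η * z))‖ / 2 := by simp
      have e5 := norm_add_le (b / z + k z) (b / (η * z) + k (η * z))
      have e6 := norm_add_le (b / z) (k z)
      have e7 := norm_add_le (b / (η * z)) (k (η * z))
      have e8 := le_abs_self C
      linarith
    have h6 : ‖b‖ * L ≤ ‖b‖ + 2 * |C| * ‖z‖ := by
      have e1 : ‖b‖ * L ≤ ‖b‖ / ‖φ‖ * ‖z‖ := by
        rw [div_mul_eq_mul_div, le_div_iff₀ hφpos]
        nlinarith
      have e2 : (‖b‖ / ‖z‖ + 2 * |C|) * ‖z‖ = ‖b‖ + 2 * |C| * ‖z‖ := by field_simp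
      calc _ ≤ _ := e1
        _ ≤ _ := mul_le_mul_of_nonneg_right h5 hzpos.le
        _ = _ := e2
    rw [lt_div_iff₀ (by positivity)] at hz3
    nlinarith
  have hclU : ∀ z ∈ closure W, z ∈ U := by
    intro z hz
    have h1 : z ∈ {z : ℂ | ‖z‖ ≤ ρ} :=
      closure_minimal hWρ (isClosed_le continuous_norm continuous_const) hz
    have h2 : z ∈ {z : ℂ | ε ≤ ‖z‖} :=
      closure_minimal hWε (isClosed_le continuous_const continuous_norm) hz
    exact ⟨mem_ball_zero_iff.2 (h1.trans_lt hρ), norm_pos_iff.1 (hεpos.trans_le h2)⟩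
  have hclO : closure W ⊆ O := by
    intro z hz
    refine ⟨hclU z hz, ?_⟩
    have hcont : ContinuousWithinAt m W z :=
      (hmd.continuousOn z (hclU z hz)).mono fun y hy => hy.1.1
    have h1 : m z ∈ closure (m '' W) := hcont.mem_closure_image hz
    have h2 : m z ∈ (thickening δ K)ᶜ :=
      closure_minimal (by rintro _ ⟨y, hy, rfl⟩; exact hWm y hy) isOpen_thickening.isClosed_compl h1
    by_contra hcon
    exact h2 (self_subset_thickening hδ K hcon)
  have hWb : Bornology.IsBounded W := isBounded_ball.subset fun z hz => hz.1.1.1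
  have hmax := Complex.norm_le_of_forall_mem_frontier_norm_le hWb
    -- W is open and its closure lies in O, so a frontier point with |v| > L would belong to W.
    (f := v) (C := L) ⟨hvd.mono inter_subset_left, hvd.continuousOn.mono hclO⟩ (fun z hz => by
      rw [frontier, hWo.interior_eq] at hz
      by_contra! hcon
      exact hz.2 ⟨hclO hz.1, hcon⟩) (subset_closure (⟨hxO, hvx⟩ : x ∈ W))
  linarith

/-- The curvature inequality `Re (1 + z h'' / h') ≤ 0` for a map onto the exterior of a convex
set, multiplied by `|h'|²`. -/
lemma re_curvature_nonpos {b : ℂ} (hb : b ≠ 0) {k : ℂ → ℂ}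
    (hk : DifferentiableOn ℂ k (ball 0 1))
    (hi : InjOn (fun z => b / z + k z) (ball 0 1 \ {0}))
    (hc : Convex ℝ ((fun z => b / z + k z) '' (ball 0 1 \ {0}))ᶜ)
    {x : ℂ} (hx : x ∈ ball (0 : ℂ) 1 \ {0}) {d₁ d₂ : ℂ} {h' : ℂ → ℂ}
    (hh' : ∀ z ∈ ball (0 : ℂ) 1 \ {0}, HasDerivAt (fun z => b / z + k z) (h' z) z)
    (h1 : h' x = d₁) (h2 : HasDerivAt h' d₂ x) :
    ((d₁ + x * d₂) * (starRingEnd ℂ) d₁).re ≤ 0 := by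
  have hd := differentiableOn_add_pole (b := b) hk
  have hmid := fun {η : ℂ} (hη : ‖η‖ = 1) {x y : ℂ} => norm_le_of_midpoint_eq hb hk hi hc hη (x := x) (y := y)
  set h : ℂ → ℂ := fun z => b / z + k z with hh
  obtain ⟨g, hg, hgh⟩ := exists_differentiableOn_inverse isOpen_punctured_ball hd hi
  have hOo : IsOpen (h '' (ball 0 1 \ {0})) := isOpen_image_of_injOn isOpen_punctured_ball hd hi
  set U := ball (0 : ℂ) 1 \ {0} with hU
  have hUo : IsOpen U := isOpen_punctured_ball
  set e : ℂ → ℂ := fun t => x * Complex.exp (Complex.I * t) with he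
  have he0 : e 0 = x := by simp [he]
  have hed : ∀ t, HasDerivAt e (Complex.I * e t) t := by
    intro t
    have := (((hasDerivAt_id t).const_mul Complex.I).cexp).const_mul x
    exact this.congr_deriv (by simp [he]; ring)
  have heU : ∀ᶠ t in 𝓝 (0 : ℂ), e t ∈ U :=
    (hed 0).continuousAt.eventually_mem (by rw [he0]; exact hUo.mem_nhds hx)
  set G : ℂ → ℂ := fun t => h (e t) with hG
  set G' : ℂ → ℂ := fun t => h' (e t) * (Complex.I * e t) with hG'
  have hGd : ∀ᶠ t in 𝓝 (0 : ℂ), HasDerivAt G (G' t) t := by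
    filter_upwards [heU] with t ht
    exact (hh' _ ht).comp t (hed t)
  have hG'd : HasDerivAt G' (-(x * (d₁ + x * d₂))) 0 := by
    have h3 : HasDerivAt (fun t => h' (e t)) (d₂ * (Complex.I * e 0)) 0 :=
      HasDerivAt.comp (0 : ℂ) (h₂ := h') (by rw [he0]; exact h2) (hed 0)
    have := h3.mul ((hed 0).const_mul Complex.I)
    refine this.congr_deriv ?_
    rw [he0, h1]
    linear_combination (x * (d₁ + x * d₂)) * Complex.I_mul_I
  obtain ⟨Q, hQc, hQ0, hQ⟩ := exists_second_order_expansion hGd hG'd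
  -- Averaging over ±t cancels the first-order term, so `N 0` is half the second derivative of G at
  -- 0.
  set m : ℂ → ℂ := fun t => (G t + G (-t)) / 2 with hm
  set N : ℂ → ℂ := fun t => (Q t + Q (-t)) / 2 with hN
  have hmN : ∀ t, m t = h x + t ^ 2 * N t := by
    intro t
    have e1 := hQ t
    have e2 := hQ (-t)
    have e3 : G 0 = h x := by simp [hG, he0]
    simp only [hm, hN, e1, e2, e3]
    ring
  have hNc : ContinuousAt N 0 := by
    refine (hQc.add (ContinuousAt.comp (g := Q) (by simpa using hQc) continuousAt_neg)).div_const 2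
  have hmc : ContinuousAt m 0 := by
    have : m = fun t => h x + t ^ 2 * N t := funext hmN
    rw [this]
    exact continuousAt_const.add ((continuousAt_id.pow 2).mul hNc)
  have hm0 : m 0 = h x := by simp [hmN]
  have hhxO : h x ∈ h '' U := ⟨x, hx, rfl⟩
  set φ : ℂ → ℂ := fun t => g (m t) with hφ
  have hgc : ContinuousAt g (m 0) := by
    rw [hm0]; exact hg.continuousOn.continuousAt (hOo.mem_nhds hhxO)
  have hφc : ContinuousAt φ 0 := ContinuousAt.comp (g := g) hgc hmc
  have hφ0 : φ 0 = x := by simp only [hφ, hm0, hgh x hx]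
  have hmO : ∀ᶠ t in 𝓝 (0 : ℂ), m t ∈ h '' U :=
    hmc.eventually_mem (by rw [hm0]; exact hOo.mem_nhds hhxO)
  set E : ℂ → ℂ := fun t => dslope h x (φ t) with hE
  have hEc : ContinuousAt E 0 := by
    refine ContinuousAt.comp (g := dslope h x) ?_ hφc
    rw [hφ0]
    exact continuousAt_dslope_same.2 (hh' x hx).differentiableAt
  have hE0 : E 0 = d₁ := by
    simp only [hE, hφ0, dslope_same, (hh' x hx).deriv, h1]
  have hreal : Tendsto (fun s : ℝ => (s : ℂ)) (𝓝[>] 0) (𝓝 0) :=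
    (Complex.continuous_ofReal.tendsto' 0 0 (by simp)).mono_left nhdsWithin_le_nhds
  have hreal' : Tendsto (fun s : ℝ => -(s : ℂ)) (𝓝[>] 0) (𝓝 0) := by simpa using hreal.neg
  -- With y the preimage of the midpoint m s and E s the divided difference of h between x and y,
  -- y·E = x·E + s²N. Since |x| ≤ |y|, |xE| ≤ |xE + s²N|; expand and divide by s².
  have hineq : ∀ᶠ s : ℝ in 𝓝[>] 0,
      0 ≤ 2 * ((starRingEnd ℂ) (x * E s) * N s).re + s ^ 2 * ‖N s‖ ^ 2 := by
    filter_upwards [hreal.eventually hmO, hreal.eventually heU, self_mem_nhdsWithin,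
      hreal'.eventually heU] with s hs1 hs2 hs3 hs4
    obtain ⟨y, hy, hys⟩ := hs1
    have hφy : φ s = y := by simp only [hφ, ← hys, hgh y hy]
    have hnorm : ∀ s : ℝ, ‖Complex.exp (Complex.I * s)‖ = 1 := fun s => by
      rw [mul_comm, Complex.norm_exp_ofReal_mul_I]
    have hxy : ‖x‖ ≤ ‖y‖ := by
      -- The midpoint lemma is applied at e(-s), and rotation by 2s leads to e(s).
      have hη : ‖Complex.exp (Complex.I * ((2 * s : ℝ) : ℂ))‖ = 1 := hnorm _
      have hmul : Complex.exp (Complex.I * ((2 * s : ℝ) : ℂ)) * e (-s) = e s := by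
        simp only [he]
        rw [mul_left_comm, ← Complex.exp_add]
        congr 2
        push_cast
        ring_nf
      have h4 := hmid hη hs4 hy (by
        rw [hmul]
        show h y = (h (e (-s)) + h (e s)) / 2
        rw [hys, hm, hG]
        ring)
      have h5 : ‖e (-s)‖ = ‖x‖ := by
        have := hnorm (-s)
        push_cast at this
        simp only [he]
        rw [norm_mul, this, mul_one]
      rwa [h5] at h4
    have hkey : y * E s = x * E s + s ^ 2 * N s := by
      have h4 := sub_smul_dslope h x (φ s)
      rw [hφy] at h4
      have h5 := hmN s
      rw [← hys] at h5
      simp only [hE, hφy]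
      rw [smul_eq_mul] at h4
      linear_combination h4 + h5
    have h6 : ‖x * E s‖ ^ 2 ≤ ‖x * E s + s ^ 2 * N s‖ ^ 2 := by
      rw [← hkey, norm_mul, norm_mul]
      gcongr
    have h7 : ‖x * E s + s ^ 2 * N s‖ ^ 2 = ‖x * E s‖ ^ 2
        + s ^ 2 * (2 * ((starRingEnd ℂ) (x * E s) * N s).re + s ^ 2 * ‖N s‖ ^ 2) := by
      rw [← Complex.normSq_eq_norm_sq, ← Complex.normSq_eq_norm_sq, ← Complex.normSq_eq_norm_sq]
      set A := x * E s
      have : (s : ℂ) ^ 2 * N s = ((s ^ 2 : ℝ) : ℂ) * N s := by push_cast; rfl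
      rw [this]
      simp only [Complex.normSq_apply, Complex.add_re, Complex.add_im, Complex.mul_re,
        Complex.mul_im, Complex.ofReal_re, Complex.ofReal_im, Complex.conj_re, Complex.conj_im]
      ring
    have h8 : 0 ≤ s ^ 2 * (2 * ((starRingEnd ℂ) (x * E s) * N s).re + s ^ 2 * ‖N s‖ ^ 2) := by
      linarith
    exact nonneg_of_mul_nonneg_right h8 (pow_pos hs3 2)
  have hlim : Tendsto (fun s : ℝ => 2 * ((starRingEnd ℂ) (x * E s) * N s).re + s ^ 2 * ‖N s‖ ^ 2)
      (𝓝[>] 0) (𝓝 (2 * ((starRingEnd ℂ) (x * E 0) * N 0).re + 0 ^ 2 * ‖N 0‖ ^ 2)) := by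
    have hN' := hNc.tendsto.comp hreal
    have hE' := hEc.tendsto.comp hreal
    have hid : Tendsto (fun s : ℝ => s) (𝓝[>] 0) (𝓝 0) := tendsto_id.mono_left nhdsWithin_le_nhds
    refine Tendsto.add (Tendsto.const_mul 2 ?_) ((hid.pow 2).mul (hN'.norm.pow 2))
    exact (Complex.continuous_re.tendsto _).comp
      (((Complex.continuous_conj.tendsto _).comp (hE'.const_mul x)).mul hN')
  have hfin := ge_of_tendsto hlim hineq
  have hN0 : N 0 = -(x * (d₁ + x * d₂)) / 2 := by simp [hN, hQ0]
  rw [hE0, hN0] at hfin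
  have h9 : ((starRingEnd ℂ) (x * d₁) * (-(x * (d₁ + x * d₂)) / 2)).re
      = -(‖x‖ ^ 2 * ((d₁ + x * d₂) * (starRingEnd ℂ) d₁).re) / 2 := by
    have : (starRingEnd ℂ) (x * d₁) * (-(x * (d₁ + x * d₂)) / 2)
        = ((-(‖x‖ ^ 2) / 2 : ℝ) : ℂ) * ((d₁ + x * d₂) * (starRingEnd ℂ) d₁) := by
      push_cast
      rw [← Complex.mul_conj', map_mul]
      ring
    rw [this, Complex.re_ofReal_mul]
    ring
  rw [h9] at hfin
  have hxpos : 0 < ‖x‖ ^ 2 := by have := norm_pos_iff.2 hx.2; positivity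
  by_contra! hcon
  have := mul_pos hxpos hcon
  linarith

/-! ### Bound for the derivative of the regular part -/

/-- At a maximum of the modulus on a disc, `z f' / f` is real and nonnegative. -/
lemma exists_mul_deriv_eq_of_isMaxOn {f : ℂ → ℂ} {z f' : ℂ} (hf : HasDerivAt f f' z)
    (hmax : ∀ w, ‖w‖ ≤ ‖z‖ → ‖f w‖ ≤ ‖f z‖) (hz : f z ≠ 0) :
    ∃ m : ℝ, 0 ≤ m ∧ z * f' = m * f z := by
  -- For each s the spiral z·exp(t(-1 + is)), t ≥ 0, stays in the disc, so |f|² cannot increase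
  -- along it at t = 0. The resulting inequality is affine in s and holds for all real s, which
  -- kills the imaginary part.
  have key : ∀ s : ℝ, ((starRingEnd ℂ) (f z) * (f' * (z * (-1 + s * Complex.I)))).re ≤ 0 := by
    intro s
    set c : ℂ := -1 + s * Complex.I
    set γ : ℝ → ℂ := fun t => z * Complex.exp ((t : ℂ) * c) with hγ
    have hγ0 : γ 0 = z := by simp [hγ]
    have hγd : HasDerivAt γ (z * c) 0 := by
      have h1 : HasDerivAt (fun w : ℂ => z * Complex.exp (w * c)) (z * c) ((0 : ℝ) : ℂ) := by
        have := (((hasDerivAt_id ((0 : ℝ) : ℂ)).mul_const c).cexp).const_mul z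
        simpa using this
      exact h1.comp_ofReal
    have hfγ : HasDerivAt (fun t => f (γ t)) (f' * (z * c)) 0 := by
      have h2 : HasDerivAt f f' (γ 0) := by rw [hγ0]; exact hf
      exact h2.scomp (0 : ℝ) hγd |>.congr_deriv (by rw [smul_eq_mul, mul_comm])
    have hn := hfγ.norm_sq
    rw [hγ0] at hn
    have hle : ∀ t : ℝ, 0 ≤ t → ‖f (γ t)‖ ^ 2 ≤ ‖f (γ 0)‖ ^ 2 := by
      intro t ht
      rw [hγ0]
      have : ‖γ t‖ ≤ ‖z‖ := by
        rw [hγ, norm_mul, Complex.norm_exp]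
        refine mul_le_of_le_one_right (norm_nonneg _) (Real.exp_le_one_iff.2 ?_)
        simp [c, ht]
      have := hmax _ this
      gcongr
    have hslope := (hasDerivAt_iff_tendsto_slope.1 hn).mono_left
      (nhdsWithin_mono (0 : ℝ) (fun t (ht : 0 < t) => ht.ne') : 𝓝[>] (0 : ℝ) ≤ 𝓝[≠] 0)
    have hle2 := le_of_tendsto hslope (b := 0) (by
      filter_upwards [self_mem_nhdsWithin] with t (ht : 0 < t)
      rw [slope_def_field]
      refine div_nonpos_of_nonpos_of_nonneg ?_ (by linarith)
      linarith [hle t ht.le])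
    rw [Complex.inner, mul_comm (f' * (z * c))] at hle2
    linarith
  set Z := (starRingEnd ℂ) (f z) * (f' * z) with hZ
  have key' : ∀ s : ℝ, -Z.re - s * Z.im ≤ 0 := by
    intro s
    have h1 := key s
    have h2 : (starRingEnd ℂ) (f z) * (f' * (z * (-1 + s * Complex.I)))
        = -Z + (s : ℂ) * (Z * Complex.I) := by rw [hZ]; ring
    rw [h2] at h1
    simp only [Complex.add_re, Complex.neg_re, Complex.re_ofReal_mul, Complex.mul_I_re] at h1
    linarith
  have hre : 0 ≤ Z.re := by simpa using key' 0
  have him : Z.im = 0 := by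
    by_contra hne
    have h1 := key' (-(Z.re + 1) / Z.im)
    rw [div_mul_cancel₀ _ hne] at h1
    linarith
  have hpos : 0 < ‖f z‖ ^ 2 := by have := norm_pos_iff.2 hz; positivity
  refine ⟨Z.re / ‖f z‖ ^ 2, by positivity, ?_⟩
  have hZre : (Z.re : ℂ) = Z := Complex.ext (by simp) (by simp [him])
  have hne : (‖f z‖ : ℂ) ^ 2 ≠ 0 := by exact_mod_cast hpos.ne'
  push_cast
  rw [hZre, div_mul_eq_mul_div, eq_div_iff hne, ← Complex.mul_conj', hZ]
  ring

/-- For a univalent map `b / z + k z` of the disc onto the exterior of a convex set, the regular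
part satisfies `|k'| ≤ |b|`. -/
theorem norm_deriv_regular_part_le {b : ℂ} (hb : b ≠ 0) {k : ℂ → ℂ}
    (hk : DifferentiableOn ℂ k (ball 0 1))
    (hi : InjOn (fun z => b / z + k z) (ball 0 1 \ {0}))
    (hc : Convex ℝ ((fun z => b / z + k z) '' (ball 0 1 \ {0}))ᶜ)
    {z : ℂ} (hz : z ∈ ball (0 : ℂ) 1) : ‖deriv k z‖ ≤ ‖b‖ := by
  have hbpos : 0 < ‖b‖ := norm_pos_iff.2 hb
  have hk1 : ∀ w ∈ ball (0 : ℂ) 1, HasDerivAt k (deriv k w) w := fun w hw =>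
    (hk.differentiableAt (isOpen_ball.mem_nhds hw)).hasDerivAt
  have hk'd : DifferentiableOn ℂ (deriv k) (ball 0 1) := hk.deriv isOpen_ball
  have hk2 : ∀ w ∈ ball (0 : ℂ) 1, HasDerivAt (deriv k) (deriv (deriv k) w) w := fun w hw =>
    (hk'd.differentiableAt (isOpen_ball.mem_nhds hw)).hasDerivAt
  have hbound : ∀ w ∈ ball (0 : ℂ) 1 \ {0}, ‖w‖ ^ 2 * ‖2 * deriv k w + w * deriv (deriv k) w‖
      ≤ ‖2 * b + w ^ 3 * deriv (deriv k) w‖ := by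
    intro w hw
    have hw0 : w ≠ 0 := hw.2
    have hder : ∀ u ∈ ball (0 : ℂ) 1 \ {0},
        HasDerivAt (fun z => b / z + k z) (-b / u ^ 2 + deriv k u) u := by
      intro u hu
      have hu0 : u ≠ 0 := hu.2
      have := ((hasDerivAt_const u b).div (hasDerivAt_id u) hu0).add (hk1 u hu.1)
      exact this.congr_deriv (by simp)
    have hder2 : HasDerivAt (fun u => -b / u ^ 2 + deriv k u)
        (2 * b / w ^ 3 + deriv (deriv k) w) w := by
      have := ((hasDerivAt_const w (-b)).div ((hasDerivAt_id w).pow 2) (pow_ne_zero 2 hw0)).add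
        (hk2 w hw.1)
      refine this.congr_deriv ?_
      simp
      field_simp
    have hcurv := re_curvature_nonpos hb hk hi hc hw hder rfl hder2
    set d₁ := -b / w ^ 2 + deriv k w with hd₁
    set d₂ := 2 * b / w ^ 3 + deriv (deriv k) w with hd₂
    -- |2d₁ + g|² - |g|² = 4 Re((d₁ + g) conj d₁). In 2d₁ + w d₂ the polar terms cancel.
    have hle : ‖2 * d₁ + w * d₂‖ ≤ ‖w * d₂‖ := by
      rw [← sq_le_sq₀ (norm_nonneg _) (norm_nonneg _), ← Complex.normSq_eq_norm_sq,
        ← Complex.normSq_eq_norm_sq]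
      have : Complex.normSq (2 * d₁ + w * d₂) = Complex.normSq (w * d₂)
          + 4 * ((d₁ + w * d₂) * (starRingEnd ℂ) d₁).re := by
        set g := w * d₂
        simp only [Complex.normSq_apply, Complex.add_re, Complex.add_im, Complex.mul_re,
          Complex.mul_im, Complex.re_ofNat, Complex.im_ofNat, Complex.conj_re, Complex.conj_im]
        ring
      linarith
    have e1 : 2 * d₁ + w * d₂ = 2 * deriv k w + w * deriv (deriv k) w := by
      rw [hd₁, hd₂]; field_simp; ring
    have e2 : w ^ 2 * (w * d₂) = 2 * b + w ^ 3 * deriv (deriv k) w := by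
      rw [hd₂]; field_simp
    rw [e1] at hle
    rw [← e2, norm_mul, norm_pow]
    gcongr
  have hr : ∀ r : ℝ, ‖z‖ < r → r < 1 → r ^ 2 * ‖deriv k z‖ ≤ ‖b‖ := by
    intro r hzr hr1
    have hr0 : 0 < r := (norm_nonneg z).trans_lt hzr
    have hcl : DiffContOnCl ℂ (deriv k) (ball 0 r) :=
      (hk'd.mono (closedBall_subset_ball hr1)).diffContOnCl_ball subset_rfl
    obtain ⟨w, hw, hwmax⟩ := Complex.exists_mem_frontier_isMaxOn_norm isBounded_ball
      ⟨0, mem_ball_self hr0⟩ hcl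
    rw [frontier_ball _ hr0.ne', mem_sphere_zero_iff_norm] at hw
    rw [closure_ball _ hr0.ne'] at hwmax
    have hwb : w ∈ ball (0 : ℂ) 1 := mem_ball_zero_iff.2 (hw.trans_lt hr1)
    have hw0 : w ≠ 0 := norm_pos_iff.1 (by rw [hw]; exact hr0)
    have hM : ‖deriv k z‖ ≤ ‖deriv k w‖ := hwmax (mem_closedBall_zero_iff.2 hzr.le)
    by_cases hne : deriv k w = 0
    · rw [hne, norm_zero] at hM
      have : ‖deriv k z‖ = 0 := le_antisymm hM (norm_nonneg _)
      rw [this, mul_zero]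
      exact hbpos.le
    obtain ⟨m, hm, hmw⟩ := exists_mul_deriv_eq_of_isMaxOn (hk2 w hwb) (fun u hu =>
      hwmax (mem_closedBall_zero_iff.2 (hu.trans_eq hw))) hne
    have h1 := hbound w ⟨hwb, hw0⟩
    have e1 : 2 * deriv k w + w * deriv (deriv k) w = ((2 + m : ℝ) : ℂ) * deriv k w := by
      rw [hmw]; push_cast; ring
    have e2 : w ^ 3 * deriv (deriv k) w = (m : ℂ) * (w ^ 2 * deriv k w) := by
      linear_combination w ^ 2 * hmw
    rw [e1, e2, norm_mul, Complex.norm_real, Real.norm_of_nonneg (by linarith), hw] at h1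
    have h2 : ‖2 * b + (m : ℂ) * (w ^ 2 * deriv k w)‖ ≤ 2 * ‖b‖ + m * (r ^ 2 * ‖deriv k w‖) := by
      refine (norm_add_le _ _).trans_eq ?_
      rw [norm_mul, norm_mul, norm_mul, norm_pow, hw, Complex.norm_real, Real.norm_of_nonneg hm]
      simp
    -- From (2 + m) r²|k'| ≤ 2|b| + m r²|k'| the terms in m cancel.
    have h3 : r ^ 2 * ‖deriv k w‖ ≤ ‖b‖ := by nlinarith
    exact (mul_le_mul_of_nonneg_left hM (by positivity)).trans h3
  have hz1 := mem_ball_zero_iff.1 hz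
  have hlim : Tendsto (fun r : ℝ => r ^ 2 * ‖deriv k z‖) (𝓝[<] 1) (𝓝 (1 ^ 2 * ‖deriv k z‖)) :=
    ((continuous_id.pow 2).mul continuous_const).continuousWithinAt
  have := le_of_tendsto hlim (b := ‖b‖) (by
    filter_upwards [Ioo_mem_nhdsLT hz1] with r hr'
    exact hr r hr'.1 hr'.2)
  simpa using this

/-! ### Laurent expansion at the pole -/

/-- The indices `n ≥ -1`, enumerated by the natural numbers. -/
def laurentIndexEquiv : ℕ ≃ {n : ℤ // -1 ≤ n} where
  toFun n := ⟨(n : ℤ) - 1, by omega⟩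
  invFun n := (n.1 + 1).toNat
  left_inv n := by simp
  right_inv n := by
    have := n.2
    ext
    simp
    omega

/-- Multiplying by z - p gives an ordinary power series in which a 0 has index 1, so that a 0
becomes a first derivative at p. -/
lemma HasLaurentExpansion.hasSum_nat {p : ℝ} {f : ℂ → OnePoint ℂ} {a : ℤ → ℂ}
    (h : HasLaurentExpansion p f a) {z : ℂ} (h0 : 0 < ‖z - p‖) (h1 : ‖z - p‖ < 1 - p) :
    HasSum (fun n : ℕ => a ((n : ℤ) - 1) * (z - p) ^ n) ((z - p) * sphereCoord (f z)) := by
  have h2 := (laurentIndexEquiv.hasSum_iff.2 (h z h0 h1)).mul_left (z - p)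
  refine (congrArg (HasSum · _) (funext fun n => ?_)).mp h2
  simp only [laurentIndexEquiv, Equiv.coe_fn_mk, Function.comp_apply]
  rw [zpow_sub₀ (norm_pos_iff.1 h0), zpow_one, zpow_natCast]
  field_simp [norm_pos_iff.1 h0]

/-- The constant Laurent coefficient at a simple pole is the value of the regular part. -/
lemma HasLaurentExpansion.coeff_zero_eq {p : ℝ} (hp1 : p < 1) {f : ℂ → OnePoint ℂ} {a : ℤ → ℂ}
    (h : HasLaurentExpansion p f a) {A : ℂ} {F : ℂ → ℂ} (hF : DifferentiableAt ℂ F p)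
    (hf : ∀ᶠ z in 𝓝[≠] (p : ℂ), sphereCoord (f z) = A / (z - p) + F z) : a 0 = F p := by
  set c : ℕ → ℂ := fun n => a ((n : ℤ) - 1) with hc
  set φ : ℂ → ℂ := fun z => A + (z - p) * F z with hφ
  have hφd : HasDerivAt φ (F p) p := by
    have := (((hasDerivAt_id (p : ℂ)).sub_const (p : ℂ)).mul hF.hasDerivAt).const_add A
    exact this.congr_deriv (by simp)
  -- The expansion says nothing at p itself, so the sum is first given the value c 0 there;
  -- continuity then identifies it with φ p.
  set ψ : ℂ → ℂ := Function.update φ p (c 0) with hψ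
  have hψs : HasFPowerSeriesAt ψ (FormalMultilinearSeries.ofScalars ℂ c) p := by
    rw [hasFPowerSeriesAt_iff]
    rw [eventually_nhdsWithin_iff, Metric.eventually_nhds_iff] at hf
    obtain ⟨ε, hε, hf⟩ := hf
    filter_upwards [ball_mem_nhds (0 : ℂ) (lt_min hε (sub_pos.2 hp1))] with w hw
    rw [mem_ball_zero_iff, lt_min_iff] at hw
    simp only [FormalMultilinearSeries.coeff_ofScalars, smul_eq_mul]
    by_cases hw0 : w = 0
    · subst hw0
      simp only [add_zero, hψ, Function.update_self]
      refine (congrArg (HasSum · _) (funext fun n => ?_)).mpr (hasSum_ite_eq 0 (c 0))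
      rcases eq_or_ne n 0 with rfl | hn <;> simp [*]
    · have e : (p : ℂ) + w - p = w := by ring
      have h1 := h.hasSum_nat (z := p + w) (by rw [e]; exact norm_pos_iff.2 hw0)
        (by rw [e]; exact hw.2)
      have hne : (p : ℂ) + w ≠ p := by simpa using hw0
      rw [hf (by rw [dist_eq_norm, e]; exact hw.1) hne, e] at h1
      rw [hψ, Function.update_of_ne hne, hφ]
      have e2 : A + ((p : ℂ) + w - p) * F (p + w) = w * (A / w + F (p + w)) := by
        rw [e]; field_simp
      simp only [e2]
      simpa only [mul_comm] using h1
  have hc0 : c 0 = φ p := by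
    have h1 : Tendsto ψ (𝓝[≠] (p : ℂ)) (𝓝 (ψ p)) :=
      hψs.analyticAt.continuousAt.tendsto.mono_left nhdsWithin_le_nhds
    have h2 : Tendsto φ (𝓝[≠] (p : ℂ)) (𝓝 (φ p)) :=
      hφd.continuousAt.tendsto.mono_left nhdsWithin_le_nhds
    have h3 : ψ =ᶠ[𝓝[≠] (p : ℂ)] φ := by
      filter_upwards [self_mem_nhdsWithin] with z hz
      exact Function.update_of_ne hz _ _
    have := tendsto_nhds_unique (h1.congr' h3) h2
    simpa [hψ] using this
  have hψφ : ψ = φ := by rw [hψ, hc0, Function.update_eq_self]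
  rw [hψφ] at hψs
  have h4 := hψs.deriv
  rw [hφd.deriv] at h4
  rw [h4]
  have : FormalMultilinearSeries.ofScalars ℂ c 1 (fun _ => 1)
      = (FormalMultilinearSeries.ofScalars ℂ c).coeff 1 := rfl
  rw [this, FormalMultilinearSeries.coeff_ofScalars]
  simp [hc]

/-- The disc of radius 1 - p about p lies in the unit disc, so the Taylor series of F converges
there; the principal part supplies the index -1. -/
lemma exists_hasLaurentExpansion {p : ℝ} (hp0 : 0 < p) {f : ℂ → OnePoint ℂ} {A : ℂ}
    {F : ℂ → ℂ} (hF : DifferentiableOn ℂ F (ball 0 1))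
    (hf : ∀ z ∈ ball (0 : ℂ) 1, z ≠ p → sphereCoord (f z) = A / (z - p) + F z) :
    ∃ a : ℤ → ℂ, HasLaurentExpansion p f a := by
  have hsub : ball (p : ℂ) (1 - p) ⊆ ball 0 1 := by
    refine ball_subset_ball' ?_
    rw [dist_zero_right, Complex.norm_real, Real.norm_of_nonneg hp0.le]
    linarith
  refine ⟨fun n => if n = -1 then A else ((n.toNat.factorial : ℂ))⁻¹ * iteratedDeriv n.toNat F p,
    fun z h0 h1 => ?_⟩
  have hz : z ∈ ball (p : ℂ) (1 - p) := by rwa [mem_ball, dist_eq_norm]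
  have hzp : z - p ≠ 0 := norm_pos_iff.1 h0
  rw [hf z (hsub hz) (sub_ne_zero.1 hzp), ← laurentIndexEquiv.hasSum_iff]
  have h2 := Complex.hasSum_taylorSeries_on_ball (hF.mono hsub) hz
  have h3 := (hasSum_nat_add_iff (f := (fun n : {n : ℤ // -1 ≤ n} =>
    (if (n : ℤ) = -1 then A else (((n : ℤ).toNat.factorial : ℂ))⁻¹ *
      iteratedDeriv (n : ℤ).toNat F p) * (z - p) ^ (n : ℤ)) ∘ laurentIndexEquiv)
      (g := F z) 1).1 (by
    refine (congrArg (HasSum · _) (funext fun n => ?_)).mp h2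
    have hn : ¬ ((n : ℤ) = -1) := by omega
    simp [laurentIndexEquiv, hn]
    ring)
  have h4 : F z + A * (z - p)⁻¹ = A / (z - p) + F z := by rw [add_comm, div_eq_mul_inv]
  simpa [laurentIndexEquiv, h4] using h3

/-- A concave univalent function is finite off its pole, and it is the sum of a principal part and
a function holomorphic on the disc. -/
lemma ConcaveUnivalent.exists_regular_part {p : ℝ} (hp : p ∈ Ioo (0 : ℝ) 1) {f : ℂ → OnePoint ℂ}
    (hf : ConcaveUnivalent p f) :
    (∀ z ∈ ball (0 : ℂ) 1, z ≠ p → ((sphereCoord (f z) : ℂ) : OnePoint ℂ) = f z) ∧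
    f p = OnePoint.infty ∧
    ∃ (A : ℂ) (F : ℂ → ℂ), A ≠ 0 ∧ DifferentiableOn ℂ F (ball 0 1) ∧
      ∀ z ∈ ball (0 : ℂ) 1, z ≠ p → sphereCoord (f z) = A / (z - p) + F z := by
  have hpb : (p : ℂ) ∈ ball (0 : ℂ) 1 := by
    rw [mem_ball_zero_iff, Complex.norm_real, Real.norm_of_nonneg hp.1.le]
    exact hp.2
  have hpinf : f p = OnePoint.infty := by
    rcases hf.meromorphic p hpb with h | h
    · have h1 := h.2.meromorphicOrderAt_nonneg
      rw [hf.simple_pole] at h1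
      exact absurd h1 (by decide)
    · exact h.1
  have hne : ∀ z ∈ ball (0 : ℂ) 1, z ≠ p → f z ≠ OnePoint.infty := fun z hz hzp hcon =>
    hzp (hf.injective hz hpb (hcon.trans hpinf.symm))
  have han : ∀ z ∈ ball (0 : ℂ) 1, z ≠ p → AnalyticAt ℂ (sphereCoord ∘ f) z := by
    intro z hz hzp
    rcases hf.meromorphic z hz with h | h
    · exact h.2
    · exact absurd h.1 (hne z hz hzp)
  have hmer : MeromorphicAt (sphereCoord ∘ f) p := by
    rcases hf.meromorphic p hpb with h | h
    · exact h.2.meromorphicAt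
    · exact h.2.1
  obtain ⟨g, hg, hgp, hfg⟩ := (meromorphicOrderAt_eq_int_iff hmer (n := -1)).1
    (by rw [hf.simple_pole]; rfl)
  -- Near p, f = g/(z - p), so f - g(p)/(z - p) is the divided difference of g at p, whose value at
  -- p is g'(p).
  refine ⟨fun z hz hzp => ?_, hpinf, g p,
    Function.update (fun z => sphereCoord (f z) - g p / (z - p)) p (deriv g p), hgp, ?_, ?_⟩
  · obtain ⟨w, hw⟩ := OnePoint.ne_infty_iff_exists.1 (hne z hz hzp)
    rw [← hw]; rfl
  · intro z hz
    apply DifferentiableAt.differentiableWithinAt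
    by_cases hzp : z = p
    · subst hzp
      have hgd : DifferentiableAt ℂ (dslope g p) p := by
        obtain ⟨s, hs, hgs⟩ := hg.eventually_analyticAt.exists_mem
        have h1 : DifferentiableOn ℂ g s := fun y hy =>
          (hgs y hy).differentiableAt.differentiableWithinAt
        exact ((Complex.differentiableOn_dslope hs).2 h1).differentiableAt hs
      refine hgd.congr_of_eventuallyEq ?_
      rw [eventually_nhdsWithin_iff] at hfg
      filter_upwards [hfg] with y hy
      by_cases hyp : y = p
      · rw [hyp, Function.update_self, dslope_same]
      · have hyp' : y - (p : ℂ) ≠ 0 := sub_ne_zero.2 hyp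
        rw [Function.update_of_ne hyp, dslope_of_ne _ hyp, slope_def_field]
        have := hy hyp
        simp only [Function.comp_apply, smul_eq_mul, zpow_neg, zpow_one] at this
        rw [this]
        field_simp
    · have h1 : DifferentiableAt ℂ (fun z => sphereCoord (f z) - g p / (z - p)) z :=
        (han z hz hzp).differentiableAt.sub
          ((differentiableAt_const _).div (differentiableAt_id.sub_const _) (sub_ne_zero.2 hzp))
      refine h1.congr_of_eventuallyEq ?_
      filter_upwards [isOpen_ne.mem_nhds hzp] with y hy
      exact Function.update_of_ne hy _ _
  · intro z hz hzp
    rw [Function.update_of_ne hzp]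
    ring

/-! ### The disc coordinate at the pole, the bound and the equality case -/

/-- Equality in the mean value inequality at the centre of a disc forces an affine function. -/
lemma exists_eq_affine_of_norm_sub_eq {k : ℂ → ℂ} {B : ℝ} (hk : DifferentiableOn ℂ k (ball 0 1))
    (hB : ∀ z ∈ ball (0 : ℂ) 1, ‖deriv k z‖ ≤ B) {w : ℂ} (hw : w ∈ ball (0 : ℂ) 1) (hw0 : w ≠ 0)
    (heq : ‖k w - k 0‖ = B * ‖w‖) :
    ∃ c : ℂ, ‖c‖ = B ∧ ∀ z ∈ ball (0 : ℂ) 1, k z = k 0 + c * z := by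
  have h0 : (0 : ℂ) ∈ ball (0 : ℂ) 1 := mem_ball_self one_pos
  have hq : DifferentiableOn ℂ (dslope k 0) (ball 0 1) :=
    (Complex.differentiableOn_dslope (ball_mem_nhds 0 one_pos)).2 hk
  have hle : ∀ z ∈ ball (0 : ℂ) 1, ‖dslope k 0 z‖ ≤ B := by
    intro z hz
    by_cases hz0 : z = 0
    · rw [hz0, dslope_same]; exact hB 0 h0
    · rw [dslope_of_ne _ hz0, slope_def_field, norm_div, sub_zero,
        div_le_iff₀ (norm_pos_iff.2 hz0)]
      have := Convex.norm_image_sub_le_of_norm_deriv_le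
        (fun x hx => hk.differentiableAt (isOpen_ball.mem_nhds hx)) hB (convex_ball 0 1) h0 hz
      rwa [sub_zero] at this
  have hwB : ‖dslope k 0 w‖ = B := by
    rw [dslope_of_ne _ hw0, slope_def_field, norm_div, sub_zero, heq,
      mul_div_cancel_right₀ _ (norm_ne_zero_iff.2 hw0)]
  -- The quotient (k z - k 0)/z attains its bound B at the interior point w, hence is constant.
  have hmax : IsMaxOn (norm ∘ dslope k 0) (ball 0 1) w := fun z hz => by
    simpa [hwB] using hle z hz
  have hconst := Complex.eqOn_of_isPreconnected_of_isMaxOn_norm (convex_ball (0 : ℂ) 1).isPreconnected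
    isOpen_ball hq hw hmax
  refine ⟨dslope k 0 w, hwB, fun z hz => ?_⟩
  have h1 := sub_smul_dslope k 0 z
  rw [hconst hz] at h1
  simp only [Function.const_apply, sub_zero, smul_eq_mul] at h1
  linear_combination -h1

/-- The automorphism of the unit disc that sends `0` to the real number `q`. -/
noncomputable def discShift (q : ℝ) (z : ℂ) : ℂ := (z + q) / (1 + q * z)

lemma one_add_mul_ne_zero {q : ℝ} (hq : |q| < 1) {z : ℂ} (hz : z ∈ ball (0 : ℂ) 1) :
    1 + (q : ℂ) * z ≠ 0 := by
  intro h
  have h1 : (q : ℂ) * z = -1 := by linear_combination h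
  have h2 := congrArg norm h1
  rw [norm_mul, Complex.norm_real, Real.norm_eq_abs, norm_neg, norm_one] at h2
  have h3 := mem_ball_zero_iff.1 hz
  nlinarith [norm_nonneg z, abs_nonneg q]

/-- This is |1 + qz|² - |z + q|² = (1 - q²)(1 - |z|²) > 0. -/
lemma discShift_mem_ball {q : ℝ} (hq : |q| < 1) {z : ℂ} (hz : z ∈ ball (0 : ℂ) 1) :
    discShift q z ∈ ball (0 : ℂ) 1 := by
  have hne := norm_pos_iff.2 (one_add_mul_ne_zero hq hz)
  rw [mem_ball_zero_iff, discShift, norm_div, div_lt_one hne, ← sq_lt_sq₀ (norm_nonneg _) hne.le,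
    ← Complex.normSq_eq_norm_sq, ← Complex.normSq_eq_norm_sq]
  have hz1 : z.re * z.re + z.im * z.im < 1 := by
    have := mem_ball_zero_iff.1 hz
    rw [← Complex.normSq_apply, Complex.normSq_eq_norm_sq]
    nlinarith [norm_nonneg z]
  have hq1 : q ^ 2 < 1 := (sq_lt_one_iff_abs_lt_one q).2 hq
  simp only [Complex.normSq_apply, Complex.add_re, Complex.add_im, Complex.mul_re,
    Complex.mul_im, Complex.ofReal_re, Complex.ofReal_im, Complex.one_re, Complex.one_im]
  nlinarith

lemma discShift_neg_discShift {q : ℝ} (hq : |q| < 1) {z : ℂ} (hz : z ∈ ball (0 : ℂ) 1) :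
    discShift (-q) (discShift q z) = z := by
  have hne := one_add_mul_ne_zero hq hz
  have hne' : 1 + z * (q : ℂ) ≠ 0 := by rwa [mul_comm] at hne
  have hq1 : (1 : ℂ) - q ^ 2 ≠ 0 := by
    have : q ^ 2 < 1 := (sq_lt_one_iff_abs_lt_one q).2 hq
    exact_mod_cast (sub_pos.2 this).ne'
  have h1 : discShift q z + ((-q : ℝ) : ℂ) = z * (1 - q ^ 2) / (1 + q * z) := by
    rw [discShift]; push_cast; field_simp; ring
  have h2 : 1 + ((-q : ℝ) : ℂ) * discShift q z = (1 - q ^ 2) / (1 + q * z) := by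
    rw [discShift]; push_cast; field_simp; ring
  rw [discShift, h1, h2]
  field_simp

lemma hasDerivAt_discShift {q : ℝ} (hq : |q| < 1) {z : ℂ} (hz : z ∈ ball (0 : ℂ) 1) :
    HasDerivAt (discShift q) ((1 - q ^ 2) / (1 + q * z) ^ 2) z := by
  have h1 := ((hasDerivAt_id z).add_const (q : ℂ)).div
    (((hasDerivAt_id z).const_mul (q : ℂ)).const_add 1) (one_add_mul_ne_zero hq hz)
  refine h1.congr_deriv ?_
  simp only [id, mul_one, one_mul]
  congr 1
  ring

/-- In the disc coordinate centred at the pole, the regular part of a concave univalent function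
has bounded derivative. -/
theorem ConcaveUnivalent.norm_deriv_regular_part_le {p : ℝ} (hp : p ∈ Ioo (0 : ℝ) 1)
    {f : ℂ → OnePoint ℂ} (hf : ConcaveUnivalent p f)
    (hfin : ∀ z ∈ ball (0 : ℂ) 1, z ≠ p → ((sphereCoord (f z) : ℂ) : OnePoint ℂ) = f z)
    (hinf : f p = OnePoint.infty) {A : ℂ} {F : ℂ → ℂ} (hA : A ≠ 0)
    (hF : DifferentiableOn ℂ F (ball 0 1))
    (hfF : ∀ z ∈ ball (0 : ℂ) 1, z ≠ p → sphereCoord (f z) = A / (z - p) + F z)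
    {z : ℂ} (hz : z ∈ ball (0 : ℂ) 1) :
    ‖deriv (F ∘ discShift p) z‖ ≤ ‖A‖ / (1 - p ^ 2) := by
  have hp1 : |p| < 1 := by rw [abs_of_pos hp.1]; exact hp.2
  have hp1' : |-p| < 1 := by rwa [abs_neg]
  have hp2 : 0 < 1 - p ^ 2 := by nlinarith [hp.1, hp.2]
  have hp2' : (1 : ℂ) - p ^ 2 ≠ 0 := by exact_mod_cast hp2.ne'
  have hp0 : (p : ℂ) ≠ 0 := by exact_mod_cast hp.1.ne'
  set b : ℂ := A / (1 - p ^ 2) with hb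
  have hb0 : b ≠ 0 := div_ne_zero hA hp2'
  have hbn : ‖b‖ = ‖A‖ / (1 - p ^ 2) := by
    rw [hb, norm_div]
    congr 1
    have : (1 : ℂ) - p ^ 2 = ((1 - p ^ 2 : ℝ) : ℂ) := by push_cast; rfl
    rw [this, Complex.norm_real, Real.norm_of_nonneg hp2.le]
  -- A/(S(ζ) - p) = b(1 + pζ)/ζ = b/ζ + bp for S = `discShift p`; the constant bp joins the regular
  -- part.
  set k : ℂ → ℂ := fun ζ => F (discShift p ζ) + b * p with hk
  have hkd : DifferentiableOn ℂ k (ball 0 1) := by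
    refine DifferentiableOn.add_const _ (hF.comp ?_ fun ζ hζ => discShift_mem_ball hp1 hζ)
    exact fun ζ hζ => (hasDerivAt_discShift hp1 hζ).differentiableAt.differentiableWithinAt
  have hinv : ∀ ζ ∈ ball (0 : ℂ) 1, discShift p (discShift (-p) ζ) = ζ := fun ζ hζ => by
    have := discShift_neg_discShift hp1' hζ
    rwa [neg_neg] at this
  have hS0 : ∀ ζ ∈ ball (0 : ℂ) 1, ζ ≠ 0 → discShift p ζ ≠ p := by
    intro ζ hζ h0 hcon
    have h1 := discShift_neg_discShift hp1 hζ
    rw [hcon] at h1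
    apply h0
    rw [← h1]
    simp [discShift]
  have hval : ∀ ζ ∈ ball (0 : ℂ) 1 \ {0}, b / ζ + k ζ = sphereCoord (f (discShift p ζ)) := by
    intro ζ hζ
    have hζ0 : ζ ≠ 0 := hζ.2
    rw [hfF _ (discShift_mem_ball hp1 hζ.1) (hS0 ζ hζ.1 hζ.2)]
    have hne := one_add_mul_ne_zero hp1 hζ.1
    have hne' : 1 + ζ * (p : ℂ) ≠ 0 := by rwa [mul_comm] at hne
    have h1 : discShift p ζ - p = ζ * (1 - p ^ 2) / (1 + p * ζ) := by
      rw [discShift]; field_simp; ring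
    rw [h1, hk, hb]
    field_simp
    ring
  have hinj : InjOn (fun ζ => b / ζ + k ζ) (ball 0 1 \ {0}) := by
    intro x hx y hy hxy
    simp only [hval x hx, hval y hy] at hxy
    have h1 := congrArg (fun w : ℂ => (w : OnePoint ℂ)) hxy
    simp only [hfin _ (discShift_mem_ball hp1 hx.1) (hS0 x hx.1 hx.2),
      hfin _ (discShift_mem_ball hp1 hy.1) (hS0 y hy.1 hy.2)] at h1
    have h2 := hf.injective (discShift_mem_ball hp1 hx.1) (discShift_mem_ball hp1 hy.1) h1
    rw [← discShift_neg_discShift hp1 hx.1, h2, discShift_neg_discShift hp1 hy.1]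
  have himg : ((fun ζ => b / ζ + k ζ) '' (ball 0 1 \ {0}))ᶜ
      = {w : ℂ | (w : OnePoint ℂ) ∈ (f '' ball 0 1)ᶜ} := by
    ext w
    rw [mem_compl_iff, mem_ofPred_eq, mem_compl_iff, not_iff_not]
    constructor
    · rintro ⟨ζ, hζ, rfl⟩
      refine ⟨discShift p ζ, discShift_mem_ball hp1 hζ.1, ?_⟩
      simp only [hval ζ hζ, hfin _ (discShift_mem_ball hp1 hζ.1) (hS0 ζ hζ.1 hζ.2)]
    · rintro ⟨x, hx, hxw⟩
      have hxp : x ≠ p := by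
        rintro rfl
        rw [hinf] at hxw
        exact OnePoint.infty_ne_coe _ hxw
      have hT := discShift_mem_ball hp1' hx
      have hT0 : discShift (-p) x ≠ 0 := by
        intro hcon
        have := hinv x hx
        rw [hcon] at this
        apply hxp
        rw [← this]
        simp [discShift]
      refine ⟨discShift (-p) x, ⟨hT, hT0⟩, ?_⟩
      simp only [hval _ ⟨hT, hT0⟩, hinv x hx, hxw]
      rfl
  have h1 := _root_.norm_deriv_regular_part_le hb0 hkd hinj (himg ▸ hf.convex_compl) hz
  rw [hbn] at h1
  convert h1 using 2
  rw [hk, deriv_add_const]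
  rfl

/-- The sharp bound for the constant Laurent coefficient, with the equality case. -/
theorem ConcaveUnivalent.re_regular_part_ge {p : ℝ} (hp : p ∈ Ioo (0 : ℝ) 1)
    {f : ℂ → OnePoint ℂ} (hf : ConcaveUnivalent p f)
    (hfin : ∀ z ∈ ball (0 : ℂ) 1, z ≠ p → ((sphereCoord (f z) : ℂ) : OnePoint ℂ) = f z)
    (hinf : f p = OnePoint.infty) {A : ℂ} {F : ℂ → ℂ} (hA : A ≠ 0)
    (hF : DifferentiableOn ℂ F (ball 0 1))
    (hfF : ∀ z ∈ ball (0 : ℂ) 1, z ≠ p → sphereCoord (f z) = A / (z - p) + F z) :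
    -(p / (1 - p ^ 2) ^ 2) ≤ (F p).re ∧
      ((F p).re = -(p / (1 - p ^ 2) ^ 2) → EqOn f (concaveExtremal p) (ball 0 1)) := by
  have hB := fun z (hz : z ∈ ball (0 : ℂ) 1) =>
    hf.norm_deriv_regular_part_le hp hfin hinf hA hF hfF hz
  obtain ⟨hp0, hplt⟩ := hp
  have hp1 : |p| < 1 := by rwa [abs_of_pos hp0]
  have hp1' : |-p| < 1 := by rwa [abs_neg]
  have hp2 : 0 < 1 - p ^ 2 := by nlinarith
  have hp2' : (1 : ℂ) - p ^ 2 ≠ 0 := by exact_mod_cast hp2.ne'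
  have hp0' : (p : ℂ) ≠ 0 := by exact_mod_cast hp0.ne'
  have h0b : (0 : ℂ) ∈ ball (0 : ℂ) 1 := mem_ball_self one_pos
  have hnpb : ((-p : ℝ) : ℂ) ∈ ball (0 : ℂ) 1 := by
    rwa [mem_ball_zero_iff, Complex.norm_real, Real.norm_eq_abs]
  have hS0 : discShift p 0 = p := by simp [discShift]
  have hSp : discShift p ((-p : ℝ) : ℂ) = 0 := by simp [discShift]
  have hSd : DifferentiableOn ℂ (F ∘ discShift p) (ball 0 1) :=
    hF.comp (fun ζ hζ => (hasDerivAt_discShift hp1 hζ).differentiableAt.differentiableWithinAt)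
      fun ζ hζ => discShift_mem_ball hp1 hζ
  have hF0 : F 0 = A / p := by
    have h1 := hfF 0 h0b hp0'.symm
    rw [hf.map_zero] at h1
    have h2 : (0 : ℂ) = A / (0 - p) + F 0 := h1
    rw [zero_sub, div_neg] at h2
    linear_combination -h2
  have hF0' : deriv F 0 = 1 + A / p ^ 2 := by
    have h1 : sphereCoord ∘ f =ᶠ[𝓝 0] fun z => A / (z - p) + F z := by
      filter_upwards [isOpen_ball.mem_nhds h0b, isOpen_ne.mem_nhds hp0'.symm] with z a b
      exact hfF z a b
    have h2 := hf.deriv_zero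
    rw [h1.deriv_eq] at h2
    have h3 : HasDerivAt (fun z => A / (z - p) + F z) (-A / (0 - p) ^ 2 + deriv F 0) 0 := by
      have := ((hasDerivAt_const (0 : ℂ) A).div ((hasDerivAt_id (0 : ℂ)).sub_const (p : ℂ))
        (by simpa using hp0')).add (hF.differentiableAt (isOpen_ball.mem_nhds h0b)).hasDerivAt
      exact this.congr_deriv (by simp)
    rw [h3.deriv] at h2
    rw [zero_sub, neg_sq] at h2
    linear_combination h2
  have hF0n : ‖deriv F 0‖ ≤ ‖A‖ := by
    have h1 := hB _ hnpb
    have h2 : HasDerivAt (F ∘ discShift p) (deriv F 0 * (1 / (1 - p ^ 2))) ((-p : ℝ) : ℂ) := by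
      have h3 : HasDerivAt F (deriv F 0) (discShift p ((-p : ℝ) : ℂ)) := by
        rw [hSp]; exact (hF.differentiableAt (isOpen_ball.mem_nhds h0b)).hasDerivAt
      refine (h3.comp _ (hasDerivAt_discShift hp1 hnpb)).congr_deriv ?_
      have h4 : (1 : ℂ) + p * ((-p : ℝ) : ℂ) = 1 - p ^ 2 := by push_cast; ring
      rw [h4]
      field_simp
    have h4 : ‖(1 : ℂ) - p ^ 2‖ = 1 - p ^ 2 := by
      have : (1 : ℂ) - p ^ 2 = ((1 - p ^ 2 : ℝ) : ℂ) := by push_cast; rfl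
      rw [this, Complex.norm_real, Real.norm_of_nonneg hp2.le]
    rw [h2.deriv, mul_one_div, norm_div, h4] at h1
    exact (div_le_div_iff_of_pos_right hp2).1 h1
  -- |A|/p² ≤ |F'(0)| + 1 ≤ |A| + 1.
  have hAn : ‖A‖ * (1 - p ^ 2) ≤ p ^ 2 := by
    have h1 : ‖A / p ^ 2‖ ≤ ‖deriv F 0‖ + 1 := by
      have : A / p ^ 2 = deriv F 0 - 1 := by rw [hF0']; ring
      rw [this]
      exact (norm_sub_le _ _).trans_eq (by simp)
    rw [norm_div, norm_pow, Complex.norm_real, Real.norm_of_nonneg hp0.le,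
      div_le_iff₀ (by positivity)] at h1
    nlinarith
  have hδ : ‖F 0 - F p‖ ≤ ‖A‖ / (1 - p ^ 2) * p := by
    have := Convex.norm_image_sub_le_of_norm_deriv_le
      (fun x hx => hSd.differentiableAt (isOpen_ball.mem_nhds hx)) hB (convex_ball 0 1) h0b hnpb
    simp only [Function.comp_apply, hS0, hSp, sub_zero] at this
    rwa [Complex.norm_real, norm_neg, Real.norm_of_nonneg hp0.le] at this
  have hsplit : (F p).re = A.re / p - (F 0 - F p).re := by
    rw [Complex.sub_re, hF0, Complex.div_ofReal_re]; ring
  have hAre : -‖A‖ ≤ A.re := by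
    have := Complex.abs_re_le_norm A
    exact neg_le_of_abs_le this
  have hδre : (F 0 - F p).re ≤ ‖F 0 - F p‖ := Complex.re_le_norm _
  have hsum : ‖A‖ / p + ‖A‖ / (1 - p ^ 2) * p = ‖A‖ * (1 - p ^ 2) / (p * (1 - p ^ 2) ^ 2) := by
    field_simp
    ring
  have htarget : p / (1 - p ^ 2) ^ 2 = p ^ 2 / (p * (1 - p ^ 2) ^ 2) := by field_simp
  have hsum' : ‖A‖ / p + ‖A‖ / (1 - p ^ 2) * p ≤ p / (1 - p ^ 2) ^ 2 := by
    rw [hsum, htarget]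
    gcongr
  have hArep : -(‖A‖ / p) ≤ A.re / p := by
    rw [← neg_div]; gcongr
  refine ⟨by linarith, fun heq => ?_⟩
  -- Equality in the sum forces equality in each estimate: A is real and negative, F(0) - F(p) is
  -- real and positive, and |A| is extremal.
  have e1 : A.re / p = -(‖A‖ / p) := by linarith
  have e2 : (F 0 - F p).re = ‖A‖ / (1 - p ^ 2) * p := by linarith
  have e3 : ‖F 0 - F p‖ = ‖A‖ / (1 - p ^ 2) * p := by linarith
  have e4 : ‖A‖ / p + ‖A‖ / (1 - p ^ 2) * p = p / (1 - p ^ 2) ^ 2 := by linarith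
  have hAnorm : ‖A‖ = p ^ 2 / (1 - p ^ 2) := by
    rw [hsum, htarget, div_left_inj' (by positivity)] at e4
    rw [eq_div_iff hp2.ne', e4]
  have hreal : ∀ w : ℂ, w.re = ‖w‖ → w = (‖w‖ : ℂ) := by
    intro w hw
    have h1 : w.im = 0 := Complex.abs_re_eq_norm.1 (by rw [hw, abs_norm])
    rw [← hw]
    exact Complex.ext (by simp) (by simp [h1])
  have hAeq : A = -(p ^ 2 / (1 - p ^ 2)) := by
    have h1 : (-A).re = ‖-A‖ := by
      rw [norm_neg, Complex.neg_re]
      field_simp at e1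
      linarith
    have h2 := hreal _ h1
    rw [norm_neg, hAnorm] at h2
    push_cast at h2
    linear_combination -h2
  have hδeq : F 0 - F p = p ^ 3 / (1 - p ^ 2) ^ 2 := by
    have h2 := hreal _ (e2.trans e3.symm)
    rw [e3, hAnorm] at h2
    rw [h2]
    push_cast
    field_simp
  obtain ⟨c, -, hc⟩ := exists_eq_affine_of_norm_sub_eq hSd hB hnpb
    (by exact_mod_cast (neg_ne_zero.2 hp0.ne')) (by
      simp only [Function.comp_apply, hS0, hSp]
      rw [e3, Complex.norm_real, norm_neg, Real.norm_of_nonneg hp0.le])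
  simp only [Function.comp_apply, hS0] at hc
  have hc1 : c = -(p ^ 2 / (1 - p ^ 2) ^ 2) := by
    have h1 := hc _ hnpb
    rw [hSp] at h1
    push_cast at h1
    have h2 : c * p = -(p ^ 2 / (1 - p ^ 2) ^ 2) * p := by
      rw [← sub_eq_iff_eq_add'] at h1
      rw [hδeq] at h1
      linear_combination h1
    exact mul_right_cancel₀ hp0' h2
  intro z hz
  by_cases hzp : z = p
  · rw [hzp, hinf, concaveExtremal, if_pos rfl]
  rw [← hfin z hz hzp, concaveExtremal, if_neg hzp]
  congr 1
  have hT := discShift_mem_ball hp1' hz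
  have h1 := hc _ hT
  have h2 := discShift_neg_discShift hp1' hz
  rw [neg_neg] at h2
  rw [h2] at h1
  have h3 : (1 : ℂ) - p * z ≠ 0 := by
    have := one_add_mul_ne_zero hp1' hz
    push_cast at this
    rwa [neg_mul, ← sub_eq_add_neg] at this
  have h4 : discShift (-p) z = (z - p) / (1 - p * z) := by
    rw [discShift]; push_cast; rw [neg_mul, ← sub_eq_add_neg, ← sub_eq_add_neg]
  have h5 : F p = A / p - p ^ 3 / (1 - p ^ 2) ^ 2 := by rw [← hF0, ← hδeq]; ring
  have h6 : z - (p : ℂ) ≠ 0 := sub_ne_zero.2 hzp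
  have h7 : (p : ℂ) - z ≠ 0 := sub_ne_zero.2 (Ne.symm hzp)
  have h8 : z / ((1 - z / p) * (1 - z * p)) = -(p * z) / ((z - p) * (1 - p * z)) := by
    have h9 : (1 : ℂ) - z / p = (p - z) / p := by field_simp
    have h10 : (1 : ℂ) - z * p = 1 - p * z := by ring
    rw [h9, h10]
    field_simp
    ring
  rw [hfF z hz hzp, h1, h5, hc1, h4, hAeq, h8]
  field_simp
  ring

/-! ### The extremal function -/

/-- No exception is needed at z = p: the dummy value at ∞ and the quotient by zero are both 0. -/
lemma sphereCoord_concaveExtremal (p : ℝ) (z : ℂ) :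
    sphereCoord (concaveExtremal p z) = z / ((1 - z / p) * (1 - z * p)) := by
  rw [concaveExtremal]
  split_ifs with h
  · by_cases hp : (p : ℂ) = 0
    · simp [h, hp, sphereCoord]
    · simp [h, hp, sphereCoord]
  · rfl

lemma one_sub_mul_ne_zero {p : ℝ} (hp : p ∈ Ioo (0 : ℝ) 1) {z : ℂ} (hz : z ∈ ball (0 : ℂ) 1) :
    1 - z * p ≠ 0 := by
  have := one_add_mul_ne_zero (q := -p) (by rw [abs_neg, abs_of_pos hp.1]; exact hp.2) hz
  push_cast at this
  rwa [neg_mul, ← sub_eq_add_neg, mul_comm] at this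

lemma one_sub_div_ne_zero {p : ℝ} (hp : p ∈ Ioo (0 : ℝ) 1) {z : ℂ} (hz : z ≠ p) :
    1 - z / (p : ℂ) ≠ 0 := by
  have hp0 : (p : ℂ) ≠ 0 := by exact_mod_cast hp.1.ne'
  rw [one_sub_div hp0]
  exact div_ne_zero (sub_ne_zero.2 hz.symm) hp0

/-- The principal part and the regular part of the extremal function. -/
lemma concaveExtremal_eq_add {p : ℝ} (hp : p ∈ Ioo (0 : ℝ) 1) {z : ℂ}
    (hz : z ∈ ball (0 : ℂ) 1) (hzp : z ≠ p) :
    sphereCoord (concaveExtremal p z)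
      = -(p ^ 2 / (1 - p ^ 2)) / (z - p) + -(p / ((1 - z * p) * (1 - p ^ 2))) := by
  have hp0 : (p : ℂ) ≠ 0 := by exact_mod_cast hp.1.ne'
  have hp2 : (1 : ℂ) - p ^ 2 ≠ 0 := by
    have : 0 < 1 - p ^ 2 := by nlinarith [hp.1, hp.2]
    exact_mod_cast this.ne'
  have h1 := one_sub_mul_ne_zero hp hz
  have h2 : z - (p : ℂ) ≠ 0 := sub_ne_zero.2 hzp
  have h3 : (1 : ℂ) - z / p = -(z - p) / p := by field_simp; ring
  rw [sphereCoord_concaveExtremal, h3]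
  field_simp
  ring

/-- For `s` in the segment `[-2, 2]`, the roots of `z² - s z + 1` lie on the unit circle. -/
lemma quadratic_ne_zero_of_norm_lt_one {s : ℝ} (hs : |s| ≤ 2) {z : ℂ} (hz : ‖z‖ < 1) :
    z ^ 2 - s * z + 1 ≠ 0 := by
  intro h
  have hre := congrArg Complex.re h
  have him := congrArg Complex.im h
  simp only [sq, Complex.add_re, Complex.sub_re, Complex.mul_re, Complex.add_im, Complex.sub_im,
    Complex.mul_im, Complex.ofReal_re, Complex.ofReal_im, Complex.one_re, Complex.one_im,
    Complex.zero_re, Complex.zero_im] at hre him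
  have hn : z.re * z.re + z.im * z.im < 1 := by
    rw [← Complex.normSq_apply, Complex.normSq_eq_norm_sq]
    nlinarith [norm_nonneg z]
  obtain ⟨hs1, hs2⟩ := abs_le.1 hs
  have h1 : z.im * (2 * z.re - s) = 0 := by linarith
  rcases mul_eq_zero.1 h1 with h2 | h2
  · rw [h2] at hre hn
    have h3 : -1 < z.re := by nlinarith
    have h4 : z.re < 1 := by nlinarith
    rcases le_total 0 z.re with h5 | h5 <;> nlinarith
  · have h3 : s = 2 * z.re := by linarith
    rw [h3] at hre
    nlinarith

/-- At z = p the cleared equation reads 0 = p², which fails just as ∞ = w does. -/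
lemma concaveExtremal_eq_coe_iff {p : ℝ} (hp : p ∈ Ioo (0 : ℝ) 1) {z w : ℂ}
    (hz : z ∈ ball (0 : ℂ) 1) :
    concaveExtremal p z = (w : OnePoint ℂ) ↔ w * ((p - z) * (1 - z * p)) = p * z := by
  have hp0 : (p : ℂ) ≠ 0 := by exact_mod_cast hp.1.ne'
  by_cases hzp : z = p
  · subst hzp
    rw [concaveExtremal, if_pos rfl]
    simp [hp0, OnePoint.infty_ne_coe]
  · rw [concaveExtremal, if_neg hzp, OnePoint.coe_eq_coe,
      div_eq_iff (mul_ne_zero (one_sub_div_ne_zero hp hzp) (one_sub_mul_ne_zero hp hz)),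
      one_sub_div hp0]
    constructor
    · intro h
      have h1 : (p : ℂ) * z = p * (w * ((p - z) / p * (1 - z * p))) := congrArg _ h
      rw [h1]; field_simp
    · intro h
      field_simp
      linear_combination -h

/-- The extremal function omits exactly a segment of the real axis. -/
lemma concaveExtremal_omitted {p : ℝ} (hp : p ∈ Ioo (0 : ℝ) 1) :
    {w : ℂ | (w : OnePoint ℂ) ∈ (concaveExtremal p '' ball 0 1)ᶜ}
      = Complex.ofRealCLM '' Icc (-(p / (1 - p) ^ 2)) (-(p / (1 + p) ^ 2)) := by
  have hp0 : (p : ℂ) ≠ 0 := by exact_mod_cast hp.1.ne'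
  obtain ⟨hp1, hp2⟩ := hp
  have hq : 0 < (1 - p) ^ 2 := by have := sub_pos.2 hp2; positivity
  ext w
  constructor
  · intro hw
    have hw' : ∀ z ∈ ball (0 : ℂ) 1, w * ((p - z) * (1 - z * p)) ≠ p * z := fun z hz hcon =>
      hw ⟨z, hz, (concaveExtremal_eq_coe_iff ⟨hp1, hp2⟩ hz).2 hcon⟩
    have hw0 : w ≠ 0 := by
      rintro rfl
      exact hw' 0 (mem_ball_self one_pos) (by simp)
    -- For w ≠ 0 the equation f(z) = w becomes z² - sz + 1 = 0, whose roots are z and 1/z. So w is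
    -- omitted exactly when both roots have modulus 1, that is, when s is real in [-2, 2].
    set s : ℂ := (1 + p ^ 2) / p + 1 / w with hs
    obtain ⟨z, hz⟩ := exists_quadratic_eq_zero (a := (1 : ℂ)) (b := -s) (c := 1) one_ne_zero
      (IsAlgClosed.exists_eq_mul_self _)
    have hroot : ∀ z : ℂ, z * z + 1 = s * z → w * ((p - z) * (1 - z * p)) = p * z := by
      intro z hz
      have h1 : w * p * s = w * (1 + p ^ 2) + p := by rw [hs]; field_simp
      linear_combination (w * p) * hz + z * h1
    have hz1 : z * z + 1 = s * z := by linear_combination hz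
    have hz0 : z ≠ 0 := by rintro rfl; simp at hz1
    have hz2 : z⁻¹ * z⁻¹ + 1 = s * z⁻¹ := by
      field_simp
      linear_combination hz1
    have hge : 1 ≤ ‖z‖ := by
      by_contra! hlt
      exact hw' z (mem_ball_zero_iff.2 hlt) (hroot z hz1)
    have hle : ‖z‖ ≤ 1 := by
      by_contra! hlt
      refine hw' z⁻¹ (mem_ball_zero_iff.2 ?_) (hroot _ hz2)
      rw [norm_inv]
      exact inv_lt_one_of_one_lt₀ hlt
    have hn : ‖z‖ = 1 := le_antisymm hle hge
    have hconj : z⁻¹ = (starRingEnd ℂ) z := Complex.inv_eq_conj hn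
    have hs2 : s = ((2 * z.re : ℝ) : ℂ) := by
      have h1 : s = z + z⁻¹ := by field_simp; linear_combination -hz1
      rw [h1, hconj, Complex.add_conj]
    have hc := abs_le.1 ((Complex.abs_re_le_norm z).trans_eq hn)
    -- Solving s = 2 Re z for w gives w = p/d, and |Re z| ≤ 1 bounds d by -(1 ± p)².
    set d : ℝ := 2 * z.re * p - (1 + p ^ 2) with hd
    have hd1 : -(1 + p) ^ 2 ≤ d := by nlinarith
    have hd2 : d ≤ -(1 - p) ^ 2 := by nlinarith
    have hd0 : d < 0 := by linarith
    refine ⟨p / d, ⟨?_, ?_⟩, ?_⟩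
    · rw [← neg_le_neg_iff, neg_neg, ← div_neg]
      exact div_le_div_of_nonneg_left hp1.le hq (by linarith)
    · rw [le_neg, ← div_neg]
      exact div_le_div_of_nonneg_left hp1.le (by linarith) (by linarith)
    · have hdc : (d : ℂ) ≠ 0 := by exact_mod_cast hd0.ne
      rw [Complex.ofRealCLM_apply, Complex.ofReal_div, div_eq_iff hdc]
      have h1 : w * p * s = w * (1 + p ^ 2) + p := by rw [hs]; field_simp
      rw [hs2] at h1
      rw [hd]
      push_cast at h1 ⊢
      linear_combination -h1
  · rintro ⟨t, ⟨ht1, ht2⟩, rfl⟩ ⟨z, hz, hzt⟩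
    rw [concaveExtremal_eq_coe_iff ⟨hp1, hp2⟩ hz, Complex.ofRealCLM_apply] at hzt
    have ht0 : t < 0 := ht2.trans_lt (neg_lt_zero.2 (by positivity))
    have ht0' : (t : ℂ) ≠ 0 := by exact_mod_cast ht0.ne
    have h1 : -t * (1 - p) ^ 2 ≤ p := by rw [← le_div_iff₀ hq]; linarith
    have h2 : p ≤ -t * (1 + p) ^ 2 := by rw [← div_le_iff₀ (by positivity)]; linarith
    refine quadratic_ne_zero_of_norm_lt_one (s := (1 + p ^ 2) / p + 1 / t) ?_ (mem_ball_zero_iff.1 hz) ?_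
    · have h3 : (1 + p ^ 2) / p + 1 / t = (-t * (1 + p ^ 2) - p) / (-t * p) := by
        have ht0'' : t ≠ 0 := ht0.ne
        field_simp
        ring
      have h4 : 0 < -t * p := by nlinarith
      rw [h3, abs_le]
      constructor
      · rw [le_div_iff₀ h4]; nlinarith
      · rw [div_le_iff₀ h4]; nlinarith
    · push_cast
      field_simp
      linear_combination hzt

lemma concaveUnivalent_concaveExtremal {p : ℝ} (hp : p ∈ Ioo (0 : ℝ) 1) :
    ConcaveUnivalent p (concaveExtremal p) := by
  have hp0 : (p : ℂ) ≠ 0 := by exact_mod_cast hp.1.ne'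
  have hpb : (p : ℂ) ∈ ball (0 : ℂ) 1 := by
    rw [mem_ball_zero_iff, Complex.norm_real, Real.norm_of_nonneg hp.1.le]
    exact hp.2
  have hfun : sphereCoord ∘ concaveExtremal p = fun z : ℂ => z / ((1 - z / p) * (1 - z * p)) :=
    funext (sphereCoord_concaveExtremal p)
  have hden : ∀ z : ℂ, AnalyticAt ℂ (fun z : ℂ => (1 - z / p) * (1 - z * p)) z := fun z => by
    fun_prop (disch := exact hp0)
  have hmer : ∀ z, MeromorphicAt (sphereCoord ∘ concaveExtremal p) z := fun z => by
    rw [hfun]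
    exact (analyticAt_id (z := z)).meromorphicAt.div (hden z).meromorphicAt
  have hord : meromorphicOrderAt (sphereCoord ∘ concaveExtremal p) (p : ℂ) = -1 := by
    refine (meromorphicOrderAt_eq_int_iff (hmer p) (n := -1)).2
      ⟨fun z => -(p * z) / (1 - z * p), ?_, ?_, ?_⟩
    · exact (by fun_prop : AnalyticAt ℂ (fun z : ℂ => -(p * z)) p).div (by fun_prop)
        (one_sub_mul_ne_zero hp hpb)
    · exact div_ne_zero (neg_ne_zero.2 (mul_ne_zero hp0 hp0)) (one_sub_mul_ne_zero hp hpb)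
    · rw [hfun]
      filter_upwards [self_mem_nhdsWithin,
        mem_nhdsWithin_of_mem_nhds (isOpen_ball.mem_nhds hpb)] with z hz hzb
      have h1 := one_sub_mul_ne_zero hp hzb
      have h2 : z - (p : ℂ) ≠ 0 := sub_ne_zero.2 hz
      have h3 : (1 : ℂ) - z / p = -(z - p) / p := by field_simp; ring
      rw [h3, zpow_neg, zpow_one, smul_eq_mul]
      field_simp
  refine ⟨fun z hz => ?_, hord, ?_, ?_, ?_, ?_⟩
  · by_cases hzp : z = p
    · right
      subst hzp
      refine ⟨if_pos rfl, hmer _, ?_⟩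
      rw [hord]
      decide
    · left
      refine ⟨by rw [concaveExtremal, if_neg hzp]; exact OnePoint.coe_ne_infty _, ?_⟩
      rw [hfun]
      exact analyticAt_id.div (hden z)
        (mul_ne_zero (one_sub_div_ne_zero hp hzp) (one_sub_mul_ne_zero hp hz))
  · rw [concaveExtremal, if_neg hp0.symm]
    simp
  · rw [hfun]
    have h1 := (hasDerivAt_id (0 : ℂ)).div (hden 0).differentiableAt.hasDerivAt (by simp)
    exact h1.deriv.trans (by simp)
  · intro z hz y hy hzy
    by_cases hzp : z = p
    · by_cases hyp : y = p
      · rw [hzp, hyp]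
      · rw [concaveExtremal, if_pos hzp, concaveExtremal, if_neg hyp] at hzy
        exact absurd hzy (OnePoint.infty_ne_coe _)
    · obtain ⟨w, hw⟩ : ∃ w : ℂ, concaveExtremal p z = w := ⟨_, if_neg hzp⟩
      have h1 := (concaveExtremal_eq_coe_iff hp hz).1 hw
      have h2 := (concaveExtremal_eq_coe_iff hp hy).1 (hzy ▸ hw)
      -- Eliminating between the two quadratics: z + 1/z = y + 1/y factors as (z - y)(1 - zy) = 0,
      -- and |zy| < 1.
      have h3 : w * p * ((z - y) * (1 - z * y)) * p = 0 := by
        linear_combination (p * z) * h2 - (p * y) * h1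
      have h4 : 1 - z * y ≠ 0 := by
        intro hcon
        have h5 : ‖z * y‖ = 1 := by rw [← sub_eq_zero.1 hcon, norm_one]
        rw [norm_mul] at h5
        have h6 := mem_ball_zero_iff.1 hz
        have h7 := mem_ball_zero_iff.1 hy
        nlinarith [norm_nonneg z, norm_nonneg y]
      by_cases hw0 : w = 0
      · rw [hw0, zero_mul, eq_comm] at h1 h2
        rw [(mul_eq_zero.1 h1).resolve_left hp0, (mul_eq_zero.1 h2).resolve_left hp0]
      · simpa [hw0, hp0, h4, sub_eq_zero] using h3
  · rw [concaveExtremal_omitted hp]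
    exact (convex_Icc _ _).is_linear_image Complex.ofRealCLM.toLinearMap.isLinear

end

theorem theorem1 (p : ℝ) (hp : p ∈ Set.Ioo (0 : ℝ) 1) :
    ConcaveUnivalent p (concaveExtremal p) ∧
    ∀ f : ℂ → OnePoint ℂ, ConcaveUnivalent p f →
      (∃ a : ℤ → ℂ, HasLaurentExpansion p f a) ∧
      ∀ a : ℤ → ℂ, HasLaurentExpansion p f a →
        -(p / (1 - p ^ 2) ^ 2) ≤ (a 0).re ∧
        ((a 0).re = -(p / (1 - p ^ 2) ^ 2) ↔
          Set.EqOn f (concaveExtremal p) (Metric.ball 0 1)) := by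
  refine ⟨concaveUnivalent_concaveExtremal hp, fun f hf => ?_⟩
  have hpb : (p : ℂ) ∈ ball (0 : ℂ) 1 := by
    rw [mem_ball_zero_iff, Complex.norm_real, Real.norm_of_nonneg hp.1.le]
    exact hp.2
  have hnear : ∀ᶠ z in nhdsWithin (p : ℂ) {(p : ℂ)}ᶜ, z ∈ ball (0 : ℂ) 1 ∧ z ≠ p := by
    filter_upwards [self_mem_nhdsWithin,
      mem_nhdsWithin_of_mem_nhds (isOpen_ball.mem_nhds hpb)] with z hz hzb
    exact ⟨hzb, hz⟩
  obtain ⟨hfin, hinf, A, F, hA, hF, hfF⟩ := hf.exists_regular_part hp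
  refine ⟨exists_hasLaurentExpansion hp.1 hF hfF, fun a ha => ?_⟩
  have ha0 : a 0 = F p := ha.coeff_zero_eq hp.2
    (hF.differentiableAt (isOpen_ball.mem_nhds hpb)) (hnear.mono fun z hz => hfF z hz.1 hz.2)
  have hmain := hf.re_regular_part_ge hp hfin hinf hA hF hfF
  rw [ha0]
  refine ⟨hmain.1, hmain.2, fun heq => ?_⟩
  have hd : DifferentiableAt ℂ (fun z : ℂ => -((p : ℂ) / ((1 - z * p) * (1 - p ^ 2)))) p := by
    have hp2 : (1 : ℂ) - p ^ 2 ≠ 0 := by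
      have : 0 < 1 - p ^ 2 := by nlinarith [hp.1, hp.2]
      exact_mod_cast this.ne'
    have hd1 : DifferentiableAt ℂ (fun z : ℂ => (1 - z * p) * (1 - (p : ℂ) ^ 2)) p := by fun_prop
    exact ((differentiableAt_const (p : ℂ)).div hd1
      (mul_ne_zero (one_sub_mul_ne_zero hp hpb) hp2)).neg
  -- The same coefficients are read off a second time, from the explicit regular part -p/((1 - zp)(1
  -- - p²)) evaluated at p.
  have h1 := ha.coeff_zero_eq hp.2 hd (hnear.mono fun z hz => by
    rw [heq hz.1]
    exact concaveExtremal_eq_add hp hz.1 hz.2)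
  rw [← ha0, h1]
  have h2 : -((p : ℂ) / ((1 - p * p) * (1 - p ^ 2))) = ((-(p / (1 - p ^ 2) ^ 2) : ℝ) : ℂ) := by
    push_cast
    rw [← sq, ← sq]
  rw [h2, Complex.ofReal_re]
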